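/- **Setting.** Let $D\ge 1$, $n\ge 2$, and write $H=D\vee\log n$. Let $P_0$ be a probability law on $\mathbb R^D$ and let $\mathbf x^{(1)},\dots,\mathbf x^{(n)}$ be i.i.d. with law $P_0$. Let $\alpha\ge 0$ be an integrable noise schedule, $m_t=\exp(-\int_0^t\alpha)$, $\sigma_t^2=1-\exp(-2\int_0^t\alpha)$, and let $X_0\sim P_0$, $X_t\mid X_0\sim\mathcal N(m_tX_0,\sigma_t^2 I_D)$ (variance preserving process), with density $p_t$ and score $s^*(x,t)=\nabla\log p_t(x)$. For an interval $[\underline t,\overline t]$ with $\sigma_{\underline t}>0$ put $$\mathcal L(s)=\int_{\underline t}^{\overline t}\mathbb E_{X_t}\|s(X_t,t)-s^*(X_t,t)\|_2^2\,dt,\qquad \ell(s,y)=\int_{\underline t}^{\overline t}\mathbb E_{X_t\mid X_0=y}\|s(X_t,t)-\nabla\log p_t(X_t\mid y)\|_2^2\,dt .$$ Let $\mathcal{NN}(L,W,S,B)$ be the class of ReLU networks with $L\ge1$ affine layers, widths $W=(W_0,\dots,W_L)$, $W_0=D+1$, $W_L=D$, at most $S$ nonzero parameters, all of absolute value at most $B$.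 Fix constants $C_x,C_{\rm clip}>0$. The clipped class $\mathcal F=\widetilde{\mathcal{NN}}(L,W,S,B)$ on $[\underline t,\overline t]$ consists of the functions $s:\mathbb R^D\times[\underline t,\overline t]\to\mathbb R^D$ obtained by truncating $x$ coordinatewise to $[-B_x,B_x]^D$ with $B_x=H^{C_x}\sigma_{\underline t}^{-1}$ and $t$ to $[\underline t,\overline t]$, rescaling this rectangle affinely to $[0,1]^{D+1}$, applying a network of $\mathcal{NN}(L,W,S,B)$, and clipping each output coordinate to $[-\kappa_t,\kappa_t]$, $\kappa_t=C_{\rm clip}\sigma_t^{-1}H^{1/2}$. Let $\mathcal N(\varepsilon,\mathcal F,\|\cdot\|_\infty)$ be its covering number in the sup norm $\sup_{x\in\mathbb R^D,\,t\in[\underline t,\overline t]}\|s(x,t)\|_\infty$. **Theorem (oracle inequality for clipped score estimation).** For all $A>0$, $a_0>0$, $C_x>0$, $C_{\rm clip}>0$ there are constants $C,A_0>0$, depending only on these four numbers, such that the following holds whenever $n^{-a_0}\le\underline t<\overline t\le n^{a_0}$ and $D\le n^{a_0}$, for all $P_0$, $\alpha$, $L,W,S,B$ as above. If $\widehat s$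 is an empirical risk minimizer that depends measurably on the randomness, $\widehat s\in\operatorname{argmin}_{s\in\mathcal F}\frac1n\sum_{i=1}^n\ell(s,\mathbf x^{(i)})$ almost surely, then $$\mathbb E\,\mathcal L(\widehat s)\;\le\; C\left[\inf_{s\in\mathcal F}\mathcal L(s)+\frac{(D\vee\log n)^2\int_{\underline t}^{\overline t}\sigma_t^{-2}dt\;\log\bigl(\mathcal N(n^{-A_0},\mathcal F,\|\cdot\|_\infty)\vee n\bigr)}{n}\right]+n^{-A}.$$ If instead $\widehat s\in\mathcal F$ is a measurable approximate minimizer, $\frac1n\sum_i\ell(\widehat s,\mathbf x^{(i)})\le\inf_{s\in\mathcal F}\frac1n\sum_i\ell(s,\mathbf x^{(i)})+n^{-A}$ almost surely, then the same bound holds with $n^{-A}$ replaced by $C\,n^{-A}$. -/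

import Mathlib

open MeasureTheory ProbabilityTheory Set
open scoped ENNReal NNReal Matrix UniformConvergence

noncomputable section

namespace ScoreOracle

/-! ### Sparse ReLU networks -/

/-- Layer values `z_0 = z`, `z_ℓ = ρ(A_ℓ z_{ℓ-1} + b_ℓ)` for `1 ≤ ℓ ≤ L - 1` with
`ρ(u) = max(u, 0)` coordinatewise, and the affine output layer `z_L = A_L z_{L-1} + b_L`.
The matrix and the shift written `A_ℓ`, `b_ℓ` on paper are `A (ℓ - 1)`, `b (ℓ - 1)` here, and only
the entries `W 0, …, W L` of the width sequence and the first `L` layers matter. -/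
def layerValue (L : ℕ) (W : ℕ → ℕ)
    (A : ∀ l : ℕ, Matrix (Fin (W (l + 1))) (Fin (W l)) ℝ)
    (b : ∀ l : ℕ, Fin (W (l + 1)) → ℝ) (z : Fin (W 0) → ℝ) : ∀ l : ℕ, Fin (W l) → ℝ
  | 0 => z
  | l + 1 => fun i =>
      if l + 1 < L then max ((A l *ᵥ layerValue L W A b z l) i + b l i) 0
      else (A l *ᵥ layerValue L W A b z l) i + b l i

/-- The class `NN(L, W, S, B)` of ReLU networks with depth `L`, widths `W 0, …, W L`, at most `S`
nonzero parameters, all of absolute value at most `B`. -/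
def sparseReLU (L : ℕ) (W : ℕ → ℕ) (S : ℕ) (B : ℝ) :
    Set ((Fin (W 0) → ℝ) → (Fin (W L) → ℝ)) :=
  {f | ∃ (A : ∀ l : ℕ, Matrix (Fin (W (l + 1))) (Fin (W l)) ℝ)
         (b : ∀ l : ℕ, Fin (W (l + 1)) → ℝ),
      (∑ l ∈ Finset.range L,
        (Nat.card {p : Fin (W (l + 1)) × Fin (W l) // A l p.1 p.2 ≠ 0}
          + Nat.card {i : Fin (W (l + 1)) // b l i ≠ 0}) ≤ S) ∧
      (∀ l < L, (∀ i j, |A l i j| ≤ B) ∧ ∀ i, |b l i| ≤ B) ∧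
      ∀ z, f z = layerValue L W A b z L}

/-! ### The variance preserving process -/

/-- `m_t = exp(-∫₀ᵗ α)`. -/
def meanCoef (α : ℝ → ℝ) (t : ℝ) : ℝ := Real.exp (-∫ u in (0 : ℝ)..t, α u)

/-- `σ_t = (1 - exp(-2 ∫₀ᵗ α))^{1/2}`. -/
def noiseStd (α : ℝ → ℝ) (t : ℝ) : ℝ := Real.sqrt (1 - Real.exp (-2 * ∫ u in (0 : ℝ)..t, α u))

/-- Density `p_t(x | y)` of `N(m_t y, σ_t² I_D)`, the conditional law of `X_t` given `X_0 = y`. -/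
def transDensity {D : ℕ} (α : ℝ → ℝ) (t : ℝ) (y x : EuclideanSpace ℝ (Fin D)) : ℝ :=
  (2 * Real.pi * noiseStd α t ^ 2) ^ (-(D : ℝ) / 2) *
    Real.exp (-‖x - meanCoef α t • y‖ ^ 2 / (2 * noiseStd α t ^ 2))

/-- The conditional law of `X_t` given `X_0 = y`. -/
def transLaw {D : ℕ} (α : ℝ → ℝ) (t : ℝ) (y : EuclideanSpace ℝ (Fin D)) :
    Measure (EuclideanSpace ℝ (Fin D)) :=
  volume.withDensity fun x => ENNReal.ofReal (transDensity α t y x)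

/-- Density `p_t(x) = ∫ p_t(x | y) P₀(dy)` of `X_t` when `X_0 ~ P₀`. -/
def margDensity {D : ℕ} (P₀ : Measure (EuclideanSpace ℝ (Fin D))) (α : ℝ → ℝ) (t : ℝ)
    (x : EuclideanSpace ℝ (Fin D)) : ℝ :=
  ∫ y, transDensity α t y x ∂P₀

/-- The law of `X_t` when `X_0 ~ P₀`. -/
def margLaw {D : ℕ} (P₀ : Measure (EuclideanSpace ℝ (Fin D))) (α : ℝ → ℝ) (t : ℝ) :
    Measure (EuclideanSpace ℝ (Fin D)) :=
  volume.withDensity fun x => ENNReal.ofReal (margDensity P₀ α t x)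

/-- The true score `s*(x, t) = ∇ log p_t(x)`. -/
def trueScore {D : ℕ} (P₀ : Measure (EuclideanSpace ℝ (Fin D))) (α : ℝ → ℝ)
    (x : EuclideanSpace ℝ (Fin D)) (t : ℝ) : EuclideanSpace ℝ (Fin D) :=
  gradient (fun x' => Real.log (margDensity P₀ α t x')) x

/-- The conditional score `∇ log p_t(x | y)`, the gradient being taken in `x`. -/
def condScore {D : ℕ} (α : ℝ → ℝ) (y x : EuclideanSpace ℝ (Fin D)) (t : ℝ) :
    EuclideanSpace ℝ (Fin D) :=
  gradient (fun x' => Real.log (transDensity α t y x')) x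

/-! ### Losses, as `[0, ∞]`-valued integrals -/

/-- `∫_a^b E_{X_t} ‖s(X_t, t) - s*(X_t, t)‖² dt`. -/
def scoreRisk {D : ℕ} (P₀ : Measure (EuclideanSpace ℝ (Fin D))) (α : ℝ → ℝ) (a b : ℝ)
    (s : EuclideanSpace ℝ (Fin D) → ℝ → EuclideanSpace ℝ (Fin D)) : ℝ≥0∞ :=
  ∫⁻ t in Icc a b, ∫⁻ x, ‖s x t - trueScore P₀ α x t‖ₑ ^ 2 ∂(margLaw P₀ α t)

/-- The interval-restricted denoising loss
`ℓ_{[a,b]}(s, y) = ∫_a^b E_{X_t | X_0 = y} ‖s(X_t, t) - ∇ log p_t(X_t | y)‖² dt`. -/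
def denoisingLoss {D : ℕ} (α : ℝ → ℝ) (a b : ℝ)
    (s : EuclideanSpace ℝ (Fin D) → ℝ → EuclideanSpace ℝ (Fin D))
    (y : EuclideanSpace ℝ (Fin D)) : ℝ≥0∞ :=
  ∫⁻ t in Icc a b, ∫⁻ x, ‖s x t - condScore α y x t‖ₑ ^ 2 ∂(transLaw α t y)

/-- The empirical denoising risk `n⁻¹ ∑ᵢ ℓ_{[a,b]}(s, xᵢ)`. -/
def empiricalRisk {D n : ℕ} (α : ℝ → ℝ) (a b : ℝ) (x : Fin n → EuclideanSpace ℝ (Fin D))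
    (s : EuclideanSpace ℝ (Fin D) → ℝ → EuclideanSpace ℝ (Fin D)) : ℝ≥0∞ :=
  (∑ i, denoisingLoss α a b s (x i)) / (n : ℝ≥0∞)

/-- `s` belongs to `F` and its empirical denoising risk exceeds that of every member of `F` by at
most `ε`; for `ε = 0` this is an empirical risk minimizer over `F`. -/
def IsApproxERM {D n : ℕ} (α : ℝ → ℝ) (a b : ℝ) (x : Fin n → EuclideanSpace ℝ (Fin D))
    (F : Set (EuclideanSpace ℝ (Fin D) → ℝ → EuclideanSpace ℝ (Fin D))) (ε : ℝ≥0∞)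
    (s : EuclideanSpace ℝ (Fin D) → ℝ → EuclideanSpace ℝ (Fin D)) : Prop :=
  s ∈ F ∧ ∀ s' ∈ F, empiricalRisk α a b x s ≤ empiricalRisk α a b x s' + ε

/-! ### The clipped class on a time slab -/

/-- `D ∨ log n`. -/
def logDim (D n : ℕ) : ℝ := max (D : ℝ) (Real.log n)

/-- Truncation `Π_{[l,u]}` of a real number. -/
def trunc (l u v : ℝ) : ℝ := max l (min u v)

/-- The truncated and rescaled network input: `(x, t)` is truncated to
`[-R, R]^D × [a, b]`, which is then mapped affinely and coordinatewise onto `[0, 1]^{D+1}`. -/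
def netInput {D : ℕ} (R a b : ℝ) (x : EuclideanSpace ℝ (Fin D)) (t : ℝ) : Fin (D + 1) → ℝ :=
  Fin.snoc (α := fun _ => ℝ) (fun i : Fin D => (trunc (-R) R (x i) + R) / (2 * R))
    ((trunc a b t - a) / (b - a))

/-- The clipped class on `[a, b]`: a network of `NN(L, W, S, B)` applied to the truncated
and rescaled input, with input box radius `R = (D ∨ log n)^{Cx} / σ_a`, and each output coordinate
clipped to `[-κ_t, κ_t]` with `κ_t = Cclip σ_t⁻¹ (D ∨ log n)^{1/2}`.
Only times `t ∈ [a, b]` matter; outside, the clipping level is frozen at the endpoint value. -/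
def clippedClass (D n : ℕ) (α : ℝ → ℝ) (a b Cx Cclip : ℝ) (L : ℕ) (W : ℕ → ℕ)
    (hW0 : W 0 = D + 1) (hWL : W L = D) (S : ℕ) (B : ℝ) :
    Set (EuclideanSpace ℝ (Fin D) → ℝ → EuclideanSpace ℝ (Fin D)) :=
  {s | ∃ f ∈ sparseReLU L W S B, ∀ x t, ∀ i : Fin D,
      s x t i =
        trunc (-(Cclip * (noiseStd α (trunc a b t))⁻¹ * logDim D n ^ (1 / 2 : ℝ)))
          (Cclip * (noiseStd α (trunc a b t))⁻¹ * logDim D n ^ (1 / 2 : ℝ))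
          (f (fun j => netInput (logDim D n ^ Cx / noiseStd α a) a b x t (Fin.cast hW0 j))
            (Fin.cast hWL.symm i))}

/-- `s` restricted to `ℝ^D × [a, b]`, in the space of functions with the extended distance
`sup_{x, t} ‖s(x, t) - s'(x, t)‖_∞`. -/
def restrictSlab {D : ℕ} (a b : ℝ)
    (s : EuclideanSpace ℝ (Fin D) → ℝ → EuclideanSpace ℝ (Fin D)) :
    (EuclideanSpace ℝ (Fin D) × Icc a b) →ᵤ (Fin D → ℝ) :=
  UniformFun.ofFun fun p i => s p.1 (p.2 : ℝ) i

/-- `log (N(ε, F, ‖·‖_∞) ∨ n) ∈ [0, ∞]` with the sup norm over `ℝ^D × [a, b]`. -/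
def logCovering {D : ℕ} (a b : ℝ) (n : ℕ) (ε : ℝ)
    (F : Set (EuclideanSpace ℝ (Fin D) → ℝ → EuclideanSpace ℝ (Fin D))) : ℝ≥0∞ :=
  (ENNReal.log
    (max (Metric.coveringNumber ε.toNNReal (restrictSlab a b '' F) : ℝ≥0∞) (n : ℝ≥0∞))).toENNReal

/-- The stochastic term
`(D ∨ log n)² (∫_a^b σ_t⁻² dt) log (N(ε, F, ‖·‖_∞) ∨ n) / n`. -/
def stochasticTerm {D : ℕ} (α : ℝ → ℝ) (a b : ℝ) (n : ℕ) (ε : ℝ)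
    (F : Set (EuclideanSpace ℝ (Fin D) → ℝ → EuclideanSpace ℝ (Fin D))) : ℝ≥0∞ :=
  ENNReal.ofReal (logDim D n ^ 2) * (∫⁻ t in Icc a b, ENNReal.ofReal ((noiseStd α t ^ 2)⁻¹))
    * logCovering a b n ε F / (n : ℝ≥0∞)

end ScoreOracle

end

/-! Score matching is least squares regression. The score of the marginal is the posterior mean of
the conditional score (`trueScore_eq`), so the mean of `ℓ(s, ·)` under `P₀` is the risk of `s` plus
a posterior variance that does not depend on `s` (`lintegral_slabLoss`). Excess loss and excess risk
therefore have the same mean, and fast rates follow from a Bernstein condition.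

For that condition, view `ℓ(s, y)` as a squared `L²` norm. If two losses are at most `K`, factoring
a difference of squares bounds the square of their difference by `4K` times the conditional squared
distance (`sq_slabLoss_sub_le`). The bound `K`, of order `D H ∫ σ⁻²`, holds for every initial point
`y`: class members are clipped, and the Gaussian score has second moment of order `D/σ²` whatever
`y` is. No tail condition on `P₀` enters.

The reference function must have bounded loss as well, and the true score need not. It is replaced
by the posterior mean of the conditional score cut at norm `4√H/σ_t`; Gaussian tails bound the risk
of this function by `K/n` (`slabDist_slabCutTarget_le`).

Bernstein's inequality then compares risk with empirical excess loss simultaneously over a finite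
`1/n` net (`exists_uniform_deviation`), at a cost of order `K log N / n`. Replacing the estimator by
its nearest net point costs `O(K/n)`, and the competitor is deterministic, so its empirical loss has
the right mean (`lintegral_risk_le`, `lintegral_slabDist_le`). Hence `A₀ = 1` suffices. -/

set_option linter.unusedSectionVars false

noncomputable section

namespace ScoreOracle

/-! ### Bias-variance decomposition for posterior means. -/

section Regression

variable {Z Y E : Type*} [MeasurableSpace Z] [MeasurableSpace Y]
  [NormedAddCommGroup E] [InnerProductSpace ℝ E] [CompleteSpace E] [MeasurableSpace E]
  [BorelSpace E] [SecondCountableTopology E]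

lemma memLp_two_of_lintegral_sq_ne_top {κ : Measure Y} {c : Y → E} (hc : Measurable c)
    (h : ∫⁻ y, ‖c y‖ₑ ^ 2 ∂κ ≠ ∞) : MemLp c 2 κ := by
  refine ⟨hc.aestronglyMeasurable, ?_⟩
  rw [eLpNorm_lt_top_iff_lintegral_rpow_enorm_lt_top (by norm_num) (by norm_num)]
  simpa using h.lt_top

lemma lintegral_enorm_sq_eq_ofReal {κ : Measure Y} {c : Y → E} (hc : MemLp c 2 κ) :
    ∫⁻ y, ‖c y‖ₑ ^ 2 ∂κ = ENNReal.ofReal (∫ y, ‖c y‖ ^ 2 ∂κ) := by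
  rw [ofReal_integral_eq_lintegral_ofReal (by simpa using hc.integrable_norm_pow (p := 2) (by norm_num))
    (Filter.Eventually.of_forall fun _ => by positivity)]
  refine lintegral_congr fun y => ?_
  rw [ENNReal.ofReal_pow (norm_nonneg _), ofReal_norm]

/-- Bias-variance decomposition around the mean of a square integrable function. -/
lemma lintegral_enorm_sub_sq (κ : Measure Y) [IsFiniteMeasure κ] {c : Y → E} (hc : Measurable c)
    (h : ∫⁻ y, ‖c y‖ₑ ^ 2 ∂κ ≠ ∞) (s : E) :
    ∫⁻ y, ‖s - c y‖ₑ ^ 2 ∂κ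
      = ‖s - ⨍ y, c y ∂κ‖ₑ ^ 2 * κ univ + ∫⁻ y, ‖(⨍ y, c y ∂κ) - c y‖ₑ ^ 2 ∂κ := by
  have hL := memLp_two_of_lintegral_sq_ne_top hc h
  have hi : Integrable c κ := hL.integrable (by norm_num)
  set m := ⨍ y, c y ∂κ with hm
  have hs : MemLp (fun y => s - c y) 2 κ := (memLp_const s).sub hL
  have hmL : MemLp (fun y => m - c y) 2 κ := (memLp_const m).sub hL
  rw [lintegral_enorm_sq_eq_ofReal hs, lintegral_enorm_sq_eq_ofReal hmL, ← ofReal_norm,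
    ← ENNReal.ofReal_pow (norm_nonneg _), ← ofReal_measureReal, ← ENNReal.ofReal_mul (by positivity),
    ← ENNReal.ofReal_add (by positivity) (by positivity)]
  congr 1
  have hmi : Integrable (fun y => m - c y) κ := (integrable_const m).sub hi
  -- The measure `κ` is not normalized, since a posterior at `(t, x)` carries mass `p_t(x)`. The
  -- mass times the average is still the integral, even for `κ = 0`, so the cross term vanishes.
  have hcross : ∫ y, inner ℝ (s - m) (m - c y) ∂κ = 0 := by
    rw [integral_inner hmi, integral_sub (integrable_const m) hi, integral_const,
      measure_smul_average, sub_self, inner_zero_right]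
  have e : ∀ y, ‖s - c y‖ ^ 2
      = (‖s - m‖ ^ 2 + 2 * inner ℝ (s - m) (m - c y)) + ‖m - c y‖ ^ 2 := fun y => by
    rw [← norm_add_sq_real]; congr 2; abel
  simp_rw [e]
  have hinner : Integrable (fun y => inner ℝ (s - m) (m - c y)) κ := hmi.const_inner _
  have h1 : Integrable (fun y => ‖s - m‖ ^ 2 + 2 * inner ℝ (s - m) (m - c y)) κ :=
    (integrable_const _).add (hinner.const_mul 2)
  rw [integral_add h1 (by simpa using hmL.integrable_norm_pow (p := 2) (by norm_num)),
    integral_add (integrable_const _) (hinner.const_mul 2), integral_const_mul, hcross,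
    integral_const]
  simp [mul_comm]

/-- The mean of a part of `c` is controlled by its second moment. -/
lemma enorm_average_sq_mul_le (κ : Measure Y) [IsFiniteMeasure κ] {c : Y → E} (hc : Measurable c)
    (h : ∫⁻ y, ‖c y‖ₑ ^ 2 ∂κ ≠ ∞) :
    ‖⨍ y, c y ∂κ‖ₑ ^ 2 * κ univ ≤ ∫⁻ y, ‖c y‖ₑ ^ 2 ∂κ := by
  have := lintegral_enorm_sub_sq κ hc h 0
  simp only [zero_sub, enorm_neg] at this
  rw [this]
  exact le_self_add

/-- The vector `v`, set to zero where its norm exceeds `R`. -/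
def normCut (R : ℝ) (v : E) : E := if ‖v‖ ≤ R then v else 0

lemma norm_normCut_le {R : ℝ} (hR : 0 ≤ R) (v : E) : ‖normCut R v‖ ≤ R := by
  unfold normCut; split_ifs <;> simp_all

lemma enorm_normCut_le (R : ℝ) (v : E) : ‖normCut R v‖ₑ ≤ ‖v‖ₑ := by
  unfold normCut; split_ifs <;> simp

lemma enorm_sub_normCut_le (R : ℝ) (v : E) : ‖v - normCut R v‖ₑ ≤ ‖v‖ₑ := by
  unfold normCut; split_ifs <;> simp

lemma measurable_normCut {R : Z → ℝ} {c : Z → E} (hR : Measurable R) (hc : Measurable c) :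
    Measurable fun z => normCut (R z) (c z) :=
  Measurable.ite (measurableSet_le hc.norm hR) hc measurable_const

/-- The posterior of `y` at `z`, not normalized: `q(z, y) P(dy)`. -/
def posterior (P : Measure Y) (q : Z → Y → ℝ) (z : Z) : Measure Y :=
  P.withDensity fun y => ENNReal.ofReal (q z y)

lemma lintegral_posterior {P : Measure Y} {q : Z → Y → ℝ} (hq : Measurable (Function.uncurry q))
    (z : Z) (f : Y → ℝ≥0∞) :
    ∫⁻ y, f y ∂(posterior P q z) = ∫⁻ y, f y * ENNReal.ofReal (q z y) ∂P := by
  have hqz : Measurable fun y => ENNReal.ofReal (q z y) :=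
    (hq.comp measurable_prodMk_left).ennreal_ofReal
  rw [posterior, lintegral_withDensity_eq_lintegral_mul_non_measurable _ hqz
    (Filter.Eventually.of_forall fun _ => ENNReal.ofReal_lt_top)]
  simp [mul_comm]

lemma posterior_univ {P : Measure Y} {q : Z → Y → ℝ} (z : Z) :
    posterior P q z univ = ∫⁻ y, ENNReal.ofReal (q z y) ∂P := by
  simp [posterior]

/-- The measure being averaged over varies with `z`. Writing the average as a quotient of two
integrals over the fixed `P` reduces the claim to measurability of parametric integrals. -/
lemma measurable_average_posterior {P : Measure Y} [SFinite P] {q : Z → Y → ℝ} {c : Z → Y → E}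
    (hq : Measurable (Function.uncurry q)) (hc : Measurable (Function.uncurry c)) :
    Measurable fun z => ⨍ y, c z y ∂(posterior P q z) := by
  have hQ : Measurable (Function.uncurry fun z y => ENNReal.ofReal (q z y)) := hq.ennreal_ofReal
  have e : ∀ z, ⨍ y, c z y ∂(posterior P q z)
      = ((∫⁻ y, ENNReal.ofReal (q z y) ∂P)⁻¹).toReal
        • ∫ y, (ENNReal.ofReal (q z y)).toReal • c z y ∂P := fun z => by
    have hQz : Measurable fun y => ENNReal.ofReal (q z y) := hQ.comp measurable_prodMk_left
    rw [average, integral_smul_measure, posterior_univ, posterior,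
      integral_withDensity_eq_integral_toReal_smul hQz
      (Filter.Eventually.of_forall fun _ => ENNReal.ofReal_lt_top)]
  simp_rw [e]
  refine Measurable.smul (Measurable.ennreal_toReal (Measurable.inv hQ.lintegral_prod_right)) ?_
  have : StronglyMeasurable (Function.uncurry fun z y => (ENNReal.ofReal (q z y)).toReal • c z y) :=
    (hQ.ennreal_toReal.smul hc).stronglyMeasurable
  exact this.integral_prod_right.measurable

lemma measurable_enorm_sub_sq_mul {q : Z → Y → ℝ} {c : Z → Y → E}
    (hq : Measurable (Function.uncurry q)) (hc : Measurable (Function.uncurry c))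
    {s : Z → E} (hs : Measurable s) :
    Measurable fun w : Z × Y => ‖s w.1 - c w.1 w.2‖ₑ ^ 2 * ENNReal.ofReal (q w.1 w.2) :=
  (((hs.comp measurable_fst).sub hc).enorm.pow_const 2).mul hq.ennreal_ofReal

lemma measurable_loss {ν : Measure Z} [SFinite ν] {q : Z → Y → ℝ} {c : Z → Y → E}
    (hq : Measurable (Function.uncurry q)) (hc : Measurable (Function.uncurry c))
    {s : Z → E} (hs : Measurable s) :
    Measurable fun y => ∫⁻ z, ‖s z - c z y‖ₑ ^ 2 * ENNReal.ofReal (q z y) ∂ν :=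
  (measurable_enorm_sub_sq_mul hq hc hs).lintegral_prod_left'

/-- Mean denoising loss = risk around the posterior mean + posterior variance. -/
lemma lintegral_loss_eq {P : Measure Y} [SFinite P] {ν : Measure Z} [SFinite ν]
    {q : Z → Y → ℝ} {c : Z → Y → E} (hq : Measurable (Function.uncurry q))
    (hc : Measurable (Function.uncurry c)) (hp : ∀ z, ∫⁻ y, ENNReal.ofReal (q z y) ∂P ≠ ∞)
    (hcq : ∀ z, ∫⁻ y, ‖c z y‖ₑ ^ 2 * ENNReal.ofReal (q z y) ∂P ≠ ∞)
    {s : Z → E} (hs : Measurable s) :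
    ∫⁻ y, ∫⁻ z, ‖s z - c z y‖ₑ ^ 2 * ENNReal.ofReal (q z y) ∂ν ∂P
      = ∫⁻ z, ‖s z - ⨍ y, c z y ∂(posterior P q z)‖ₑ ^ 2
          * (∫⁻ y, ENNReal.ofReal (q z y) ∂P) ∂ν
        + ∫⁻ z, ∫⁻ y, ‖(⨍ y, c z y ∂(posterior P q z)) - c z y‖ₑ ^ 2
          ∂(posterior P q z) ∂ν := by
  have hm := measurable_average_posterior (P := P) hq hc
  have hp' : Measurable fun z => ∫⁻ y, ENNReal.ofReal (q z y) ∂P :=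
    hq.ennreal_ofReal.lintegral_prod_right'
  have hbias : Measurable fun z => ‖s z - ⨍ y, c z y ∂(posterior P q z)‖ₑ ^ 2
      * (∫⁻ y, ENNReal.ofReal (q z y) ∂P) := ((hs.sub hm).enorm.pow_const 2).mul hp'
  have hswap := lintegral_lintegral_swap (μ := ν) (ν := P)
    (f := fun z y => ‖s z - c z y‖ₑ ^ 2 * ENNReal.ofReal (q z y))
    (measurable_enorm_sub_sq_mul hq hc hs).aemeasurable
  rw [← hswap, ← lintegral_add_left hbias]
  refine lintegral_congr fun z => ?_
  have hfin : IsFiniteMeasure (posterior P q z) := ⟨by rw [posterior_univ]; exact (hp z).lt_top⟩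
  have h := lintegral_enorm_sub_sq (posterior P q z) (c := c z) (hc.comp measurable_prodMk_left)
    (by rw [lintegral_posterior hq]; exact hcq z) (s z)
  rw [lintegral_posterior hq, posterior_univ] at h
  exact h

/-- Passing from the posterior mean of `c` to that of the cut `c` costs at most the second moment
of the part that is cut off. -/
lemma enorm_average_normCut_sub_sq_le {P : Measure Y} {q : Z → Y → ℝ} {c : Z → Y → E}
    (hq : Measurable (Function.uncurry q)) (hc : Measurable (Function.uncurry c)) (R : ℝ) (z : Z)
    (hp : ∫⁻ y, ENNReal.ofReal (q z y) ∂P ≠ ∞)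
    (hcq : ∫⁻ y, ‖c z y‖ₑ ^ 2 * ENNReal.ofReal (q z y) ∂P ≠ ∞) :
    ‖(⨍ y, normCut R (c z y) ∂(posterior P q z)) - ⨍ y, c z y ∂(posterior P q z)‖ₑ ^ 2
        * (∫⁻ y, ENNReal.ofReal (q z y) ∂P)
      ≤ ∫⁻ y, ‖c z y - normCut R (c z y)‖ₑ ^ 2 * ENNReal.ofReal (q z y) ∂P := by
  have : IsFiniteMeasure (posterior P q z) := ⟨by rw [posterior_univ]; exact hp.lt_top⟩
  have hcz : Measurable (c z) := hc.comp measurable_prodMk_left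
  have hcut : Measurable fun y => normCut R (c z y) := measurable_normCut measurable_const hcz
  have hfin : ∫⁻ y, ‖c z y‖ₑ ^ 2 ∂(posterior P q z) ≠ ∞ := by rwa [lintegral_posterior hq]
  have hfin' : ∫⁻ y, ‖normCut R (c z y)‖ₑ ^ 2 ∂(posterior P q z) ≠ ∞ :=
    ne_top_of_le_ne_top hfin (lintegral_mono fun y => by gcongr; exact enorm_normCut_le _ _)
  have hfin2 : ∫⁻ y, ‖c z y - normCut R (c z y)‖ₑ ^ 2 ∂(posterior P q z) ≠ ∞ :=
    ne_top_of_le_ne_top hfin (lintegral_mono fun y => by gcongr; exact enorm_sub_normCut_le _ _)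
  have h := enorm_average_sq_mul_le (posterior P q z) (hcz.sub hcut) hfin2
  rw [lintegral_posterior hq, posterior_univ] at h
  refine le_trans (le_of_eq ?_) h
  rw [← enorm_neg, neg_sub]
  congr 3
  simp only [average_eq, Pi.sub_apply]
  rw [integral_sub ((memLp_two_of_lintegral_sq_ne_top hcz hfin).integrable (by norm_num))
    ((memLp_two_of_lintegral_sq_ne_top hcut hfin').integrable (by norm_num)), smul_sub]

lemma norm_average_le {κ : Measure Y} [IsFiniteMeasure κ] {f : Y → E} {R : ℝ} (hR : 0 ≤ R)
    (hf : ∀ y, ‖f y‖ ≤ R) : ‖⨍ y, f y ∂κ‖ ≤ R := by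
  rw [average_eq, norm_smul, norm_inv, Real.norm_of_nonneg measureReal_nonneg]
  have h := norm_integral_le_of_norm_le_const (μ := κ) (Filter.Eventually.of_forall hf)
  rcases eq_or_lt_of_le (measureReal_nonneg (μ := κ) (s := univ)) with h0 | h0
  · simpa [← h0] using hR
  · rw [inv_mul_le_iff₀ h0]; linarith

/-- Difference of two squared `L²` norms. -/
lemma sq_lintegral_enorm_sq_sub_le {ρ : Measure Z} {f g : Z → E} (hf : Measurable f)
    (hg : Measurable g) {K : ℝ} (hK : 0 ≤ K) (hfK : ∫⁻ z, ‖f z‖ₑ ^ 2 ∂ρ ≤ ENNReal.ofReal K)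
    (hgK : ∫⁻ z, ‖g z‖ₑ ^ 2 ∂ρ ≤ ENNReal.ofReal K) :
    ((∫⁻ z, ‖f z‖ₑ ^ 2 ∂ρ).toReal - (∫⁻ z, ‖g z‖ₑ ^ 2 ∂ρ).toReal) ^ 2
      ≤ 4 * K * (∫⁻ z, ‖f z - g z‖ₑ ^ 2 ∂ρ).toReal := by
  have hfL := memLp_two_of_lintegral_sq_ne_top hf (ne_top_of_le_ne_top ENNReal.ofReal_ne_top hfK)
  have hgL := memLp_two_of_lintegral_sq_ne_top hg (ne_top_of_le_ne_top ENNReal.ofReal_ne_top hgK)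
  have key : ∀ h : Z → E, (∫⁻ z, ‖h z‖ₑ ^ 2 ∂ρ).toReal = (eLpNorm h 2 ρ).toReal ^ 2 := fun h => by
    rw [eLpNorm_eq_lintegral_rpow_enorm_toReal (by norm_num) (by norm_num), ← ENNReal.toReal_pow,
      ← ENNReal.rpow_natCast, ← ENNReal.rpow_mul]
    norm_num
  have hfK' := ENNReal.toReal_le_of_le_ofReal hK hfK
  have hgK' := ENNReal.toReal_le_of_le_ofReal hK hgK
  have hd := key (f - g)
  simp only [Pi.sub_apply] at hd
  rw [key] at hfK' hgK' ⊢
  rw [key, hd]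
  have t1 : (eLpNorm f 2 ρ).toReal ≤ (eLpNorm (f - g) 2 ρ).toReal + (eLpNorm g 2 ρ).toReal := by
    rw [← ENNReal.toReal_add (hfL.sub hgL).eLpNorm_ne_top hgL.eLpNorm_ne_top]
    refine ENNReal.toReal_mono (ENNReal.add_ne_top.2 ⟨(hfL.sub hgL).eLpNorm_ne_top, hgL.eLpNorm_ne_top⟩) ?_
    simpa using eLpNorm_add_le (hfL.sub hgL).1 hgL.1 (by norm_num)
  have t2 : (eLpNorm g 2 ρ).toReal ≤ (eLpNorm (f - g) 2 ρ).toReal + (eLpNorm f 2 ρ).toReal := by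
    rw [← ENNReal.toReal_add (hfL.sub hgL).eLpNorm_ne_top hfL.eLpNorm_ne_top]
    refine ENNReal.toReal_mono (ENNReal.add_ne_top.2 ⟨(hfL.sub hgL).eLpNorm_ne_top, hfL.eLpNorm_ne_top⟩) ?_
    rw [eLpNorm_sub_comm]
    simpa using eLpNorm_add_le (hgL.sub hfL).1 hfL.1 (by norm_num)
  have nf : 0 ≤ (eLpNorm f 2 ρ).toReal := ENNReal.toReal_nonneg
  have ng : 0 ≤ (eLpNorm g 2 ρ).toReal := ENNReal.toReal_nonneg
  have nd : 0 ≤ (eLpNorm (f - g) 2 ρ).toReal := ENNReal.toReal_nonneg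
  set x := (eLpNorm f 2 ρ).toReal
  set y := (eLpNorm g 2 ρ).toReal
  set d := (eLpNorm (f - g) 2 ρ).toReal
  -- Factor `x² - y² = (x + y)(x - y)`: the second factor is at most `d` by the reverse triangle
  -- inequality, and `(x + y)² ≤ 2(x² + y²) ≤ 4K`.
  have h1 : (x - y) ^ 2 ≤ d ^ 2 := sq_le_sq' (by linarith) (by linarith)
  have h2 : (x + y) ^ 2 ≤ 4 * K := by nlinarith [sq_nonneg (x - y)]
  calc (x ^ 2 - y ^ 2) ^ 2 = (x + y) ^ 2 * (x - y) ^ 2 := by ring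
    _ ≤ 4 * K * d ^ 2 := mul_le_mul h2 h1 (sq_nonneg _) (by positivity)

end Regression

/-! ### Bernstein bounds and the oracle inequality for a finite family. -/

section Concentration

variable {Y Ω : Type*} [MeasurableSpace Y] [MeasurableSpace Ω]

lemma integrable_of_abs_le {P : Measure Y} [IsFiniteMeasure P] {g : Y → ℝ} (hg : Measurable g)
    {M : ℝ} (h : ∀ y, |g y| ≤ M) : Integrable g P :=
  Integrable.of_bound hg.aestronglyMeasurable M (Filter.Eventually.of_forall h)

/-- Bernstein type bound on the moment generating function of an excess loss. -/
lemma mgf_neg_excess_le {P : Measure Y} [IsProbabilityMeasure P] {g : Y → ℝ} (hg : Measurable g)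
    {K lam r r' : ℝ} (hlam : 0 ≤ lam) (hb : ∀ y, |g y| ≤ K) (hlK : lam * K ≤ 1)
    (hmean : ∫ y, g y ∂P = r - r') (hvar : lam * ∫ y, g y ^ 2 ∂P ≤ (r + r') / 2) :
    mgf g P (-lam) ≤ Real.exp (-lam * (r / 2 - 3 * r' / 2)) := by
  have hgi : Integrable g P := integrable_of_abs_le hg hb
  have hg2 : Integrable (fun y => g y ^ 2) P :=
    integrable_of_abs_le (hg.pow_const 2) (M := K ^ 2) fun y => by
      rw [abs_pow]; gcongr; exact hb y
  -- The inequality `exp u ≤ 1 + u + u²` holds for `|u| ≤ 1`, which is what `hlK` provides. The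
  -- quadratic term is then absorbed by half of the risks through `hvar`.
  have hpt : ∀ y, Real.exp (-lam * g y) ≤ 1 + (-lam) * g y + lam ^ 2 * g y ^ 2 := fun y => by
    have h1 : |(-lam) * g y| ≤ 1 := by
      rw [abs_mul, abs_neg, abs_of_nonneg hlam]
      exact (mul_le_mul_of_nonneg_left (hb y) hlam).trans hlK
    have := (abs_le.1 (Real.abs_exp_sub_one_sub_id_le h1)).2
    nlinarith
  have hint : Integrable (fun y => 1 + (-lam) * g y + lam ^ 2 * g y ^ 2) P :=
    ((integrable_const 1).add (hgi.const_mul _)).add (hg2.const_mul _)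
  have hint1 : Integrable (fun y => 1 + (-lam) * g y) P :=
    (integrable_const 1).add (hgi.const_mul _)
  calc mgf g P (-lam) = ∫ y, Real.exp (-lam * g y) ∂P := rfl
    _ ≤ ∫ y, (1 + (-lam) * g y + lam ^ 2 * g y ^ 2) ∂P :=
      integral_mono_of_nonneg (Filter.Eventually.of_forall fun _ => (Real.exp_pos _).le) hint
        (Filter.Eventually.of_forall hpt)
    _ = 1 + (-lam) * (r - r') + lam * (lam * ∫ y, g y ^ 2 ∂P) := by
      rw [integral_add hint1 (hg2.const_mul _), integral_add (integrable_const 1)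
        (hgi.const_mul _), integral_const_mul, integral_const_mul, hmean]
      simp; ring
    _ ≤ 1 + (-lam) * (r - r') + lam * ((r + r') / 2) := by gcongr
    _ = -lam * (r / 2 - 3 * r' / 2) + 1 := by ring
    _ ≤ _ := Real.add_one_le_exp _

/-- By independence the exponential moment of the sum is an `n`-th power, and the centring `r/2 -
3r'/2` is the one that cancels the bound on each factor exactly. -/
lemma integral_exp_deviation_le {P : Measure Y} [IsProbabilityMeasure P] {μ : Measure Ω}
    [IsProbabilityMeasure μ] {n : ℕ} {X : Fin n → Ω → Y} (hX : ∀ i, Measurable (X i))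
    (hlaw : ∀ i, μ.map (X i) = P) (hind : iIndepFun X μ) {g : Y → ℝ} (hg : Measurable g)
    {K lam r r' : ℝ} (hlam : 0 ≤ lam) (hb : ∀ y, |g y| ≤ K) (hlK : lam * K ≤ 1)
    (hmean : ∫ y, g y ∂P = r - r') (hvar : lam * ∫ y, g y ^ 2 ∂P ≤ (r + r') / 2) :
    ∫ ω, Real.exp (lam * (n * (r / 2 - 3 * r' / 2) - ∑ i, g (X i ω))) ∂μ ≤ 1 := by
  have hY : iIndepFun (fun i ω => g (X i ω)) μ := hind.comp (fun _ => g) (fun _ => hg)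
  have hmgf : mgf (∑ i, fun ω => g (X i ω)) μ (-lam) = (mgf g P (-lam)) ^ n := by
    rw [hY.mgf_sum (fun i => hg.comp (hX i)) Finset.univ]
    have : ∀ i, mgf (fun ω => g (X i ω)) μ (-lam) = mgf g P (-lam) := fun i => by
      rw [← hlaw i, mgf_map (hX i).aemeasurable
        ((hg.const_mul _).exp.aestronglyMeasurable)]
      rfl
    simp [this]
  have e : ∀ ω, Real.exp (lam * (n * (r / 2 - 3 * r' / 2) - ∑ i, g (X i ω)))
      = Real.exp (lam * (n * (r / 2 - 3 * r' / 2)))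
        * Real.exp (-lam * (∑ i, fun ω => g (X i ω)) ω) := fun ω => by
    rw [← Real.exp_add, Finset.sum_apply]; ring_nf
  simp_rw [e]
  rw [integral_const_mul]
  change _ * mgf (∑ i, fun ω => g (X i ω)) μ (-lam) ≤ 1
  rw [hmgf]
  have h := mgf_neg_excess_le hg hlam hb hlK hmean hvar
  calc _ ≤ Real.exp (lam * (n * (r / 2 - 3 * r' / 2)))
        * (Real.exp (-lam * (r / 2 - 3 * r' / 2))) ^ n := by
        gcongr; exact mgf_nonneg
    _ = 1 := by
      rw [← Real.exp_nat_mul, ← Real.exp_add, Real.exp_eq_one_iff]; ring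

/-- The deviations of finitely many excess losses are controlled simultaneously by a random
variable of mean at most the logarithm of their number. -/
lemma exists_uniform_deviation {ι : Type*} [Fintype ι] [Nonempty ι]
    {P : Measure Y} [IsProbabilityMeasure P] {μ : Measure Ω}
    [IsProbabilityMeasure μ] {n : ℕ} {X : Fin n → Ω → Y} (hX : ∀ i, Measurable (X i))
    (hlaw : ∀ i, μ.map (X i) = P) (hind : iIndepFun X μ) {g : ι → Y → ℝ}
    (hg : ∀ j, Measurable (g j)) {K lam : ℝ} {r : ι → ℝ} {r' : ℝ} (hlam : 0 ≤ lam)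
    (hb : ∀ j y, |g j y| ≤ K) (hlK : lam * K ≤ 1) (hmean : ∀ j, ∫ y, g j y ∂P = r j - r')
    (hvar : ∀ j, lam * ∫ y, g j y ^ 2 ∂P ≤ (r j + r') / 2) :
    ∃ U : Ω → ℝ, Integrable U μ ∧ ∫ ω, U ω ∂μ ≤ Real.log (Fintype.card ι) ∧
      ∀ j ω, lam * (n * (r j / 2 - 3 * r' / 2) - ∑ i, g j (X i ω)) ≤ U ω := by
  set u : ι → Ω → ℝ := fun j ω => lam * (n * (r j / 2 - 3 * r' / 2) - ∑ i, g j (X i ω)) with hu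
  have hN : (0 : ℝ) < Fintype.card ι := by exact_mod_cast Fintype.card_pos
  have hum : ∀ j, Measurable (u j) := fun j =>
    (measurable_const.sub (Finset.measurable_sum _ fun i _ => (hg j).comp (hX i))).const_mul _
  have hui : ∀ j, Integrable (fun ω => Real.exp (u j ω)) μ := fun j => by
    refine integrable_of_abs_le (hum j).exp
      (M := Real.exp (lam * (n * (r j / 2 - 3 * r' / 2) + n * K))) fun ω => ?_
    rw [abs_of_pos (Real.exp_pos _), Real.exp_le_exp]
    refine mul_le_mul_of_nonneg_left ?_ hlam
    have : ∑ i : Fin n, -K ≤ ∑ i, g j (X i ω) :=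
      Finset.sum_le_sum fun i _ => (abs_le.1 (hb j _)).1
    simp at this
    linarith
  -- A linearized soft maximum: with `N` the cardinality, `u + 1 ≤ exp u` at `u_j - log N` gives
  -- `u_j ≤ log N - 1 + exp(u_j)/N`. Summing the exponentials makes the bound uniform in `j`, and
  -- each has mean at most 1.
  refine ⟨fun ω => (Real.log (Fintype.card ι) - 1) + (Fintype.card ι : ℝ)⁻¹
    * ∑ j, Real.exp (u j ω), ?_, ?_, fun j ω => ?_⟩
  · exact (integrable_const _).add ((integrable_finsetSum _ fun j _ => hui j).const_mul _)
  · rw [integral_add (integrable_const _) ((integrable_finsetSum _ fun j _ => hui j).const_mul _),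
      integral_const_mul, integral_finsetSum _ fun j _ => hui j]
    have : ∑ j, ∫ ω, Real.exp (u j ω) ∂μ ≤ ∑ j : ι, (1 : ℝ) := Finset.sum_le_sum fun j _ =>
      integral_exp_deviation_le hX hlaw hind (hg j) hlam (hb j) hlK (hmean j) (hvar j)
    simp only [integral_const, probReal_univ, one_smul, Finset.sum_const, nsmul_eq_mul, mul_one,
      Finset.card_univ] at this ⊢
    have : (Fintype.card ι : ℝ)⁻¹ * ∑ j, ∫ ω, Real.exp (u j ω) ∂μ ≤ 1 := by
      rw [inv_mul_le_iff₀ hN]; linarith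
    linarith
  · have h1 := Real.add_one_le_exp (u j ω - Real.log (Fintype.card ι))
    rw [Real.exp_sub, Real.exp_log hN, div_eq_inv_mul] at h1
    have h2 : Real.exp (u j ω) ≤ ∑ j, Real.exp (u j ω) :=
      Finset.single_le_sum (f := fun j => Real.exp (u j ω)) (fun _ _ => (Real.exp_pos _).le)
        (Finset.mem_univ j)
    have h3 := mul_le_mul_of_nonneg_left h2 (inv_nonneg.2 hN.le)
    change u j ω ≤ _
    linarith

/-- Oracle inequality for bounded excess losses, for a family of finitely many candidates to one of
which the estimator is close. The risks `r j`, `r'`, `r₀` differ from the mean losses by the same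
constant `v`. -/
lemma lintegral_risk_le {ι : Type*} [Fintype ι] [Nonempty ι]
    {P : Measure Y} [IsProbabilityMeasure P] {μ : Measure Ω}
    [IsProbabilityMeasure μ] {n : ℕ} (hn : 0 < n) {X : Fin n → Ω → Y} (hX : ∀ i, Measurable (X i))
    (hlaw : ∀ i, μ.map (X i) = P) (hind : iIndepFun X μ) {l : ι → Y → ℝ} {l' l₀ : Y → ℝ}
    (hl : ∀ j, Measurable (l j)) (hl' : Measurable l') (hl₀ : Measurable l₀) {K : ℝ} (hK : 0 < K)
    (hlb : ∀ j y, l j y ∈ Icc 0 K) (hlb' : ∀ y, l' y ∈ Icc 0 K) (hlb₀ : ∀ y, l₀ y ∈ Icc 0 K)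
    {r : ι → ℝ} {r' r₀ v : ℝ}
    (hm : ∀ j, ∫ y, l j y ∂P = r j + v) (hm' : ∫ y, l' y ∂P = r' + v)
    (hm₀ : ∫ y, l₀ y ∂P = r₀ + v)
    (hvar : ∀ j, ∫ y, (l j y - l' y) ^ 2 ∂P ≤ 8 * K * (r j + r'))
    {T : Ω → ℝ} (hT : ∀ ω, 0 ≤ T ω) {δ δ' : ℝ}
    (hTj : ∀ᵐ ω ∂μ, ∃ j, T ω ≤ 2 * r j + δ ∧
      (∑ i, l j (X i ω)) / n ≤ (∑ i, l₀ (X i ω)) / n + δ') :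
    ∫⁻ ω, ENNReal.ofReal (T ω) ∂μ
      ≤ ENNReal.ofReal (4 * r₀ + 2 * r' + 4 * δ' + δ
          + 64 * K * Real.log (Fintype.card ι) / n) := by
  have hn' : (0 : ℝ) < n := by exact_mod_cast hn
  -- With this value `lam * 8K = 1/2`, so the variance bound becomes exactly `(r j + r')/2`.
  set lam : ℝ := 1 / (16 * K) with hlamdef
  have hlam : 0 < lam := by positivity
  have hli : ∀ {f : Y → ℝ}, Measurable f → (∀ y, f y ∈ Icc 0 K) → Integrable f P :=
    fun hf hfb => integrable_of_abs_le hf (M := K) fun y => by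
      rw [abs_of_nonneg (hfb y).1]; exact (hfb y).2
  obtain ⟨U, hUi, hUle, hU⟩ := exists_uniform_deviation (g := fun j y => l j y - l' y) (K := K)
    (lam := lam) (r := r) (r' := r') hX hlaw hind (fun j => (hl j).sub hl') hlam.le
    (fun j y => abs_le.2 ⟨by linarith [(hlb j y).1, (hlb' y).2], by linarith [(hlb j y).2, (hlb' y).1]⟩)
    (by rw [hlamdef, one_div_mul_eq_div, div_le_one (by positivity)]; linarith)
    (fun j => by rw [integral_sub (hli (hl j) (hlb j)) (hli hl' hlb'), hm, hm']; ring)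
    (fun j => by
      refine (mul_le_mul_of_nonneg_left (hvar j) hlam.le).trans (le_of_eq ?_)
      rw [hlamdef]; field_simp; ring)
  -- Solving the deviation bound for the risk gives `r j ≤ 3r' + 2·(empirical excess) + 32 K U/n`;
  -- it enters twice through `T ≤ 2 r j + δ`. Since `l₀` is deterministic, its empirical excess over
  -- `l'` has mean `r₀ - r'`, which leaves `4r₀ + 2r'`.
  set G : Ω → ℝ := fun ω => 4 * ((n : ℝ)⁻¹ * ∑ i, (l₀ (X i ω) - l' (X i ω))) +
    (6 * r' + 4 * δ' + δ + 64 * K / n * U ω) with hG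
  have hle : ∀ᵐ ω ∂μ, T ω ≤ G ω := by
    filter_upwards [hTj] with ω hω
    obtain ⟨j, h1, h2⟩ := hω
    have h3 := hU j ω
    rw [Finset.sum_sub_distrib] at h3
    have h4 : (r j / 2 - 3 * r' / 2) - ((∑ i, l j (X i ω)) / n - (∑ i, l' (X i ω)) / n)
        ≤ 16 * K / n * U ω := by
      have : (r j / 2 - 3 * r' / 2) - ((∑ i, l j (X i ω)) / n - (∑ i, l' (X i ω)) / n)
        = 16 * K / n * (lam * (n * (r j / 2 - 3 * r' / 2)
          - (∑ i, l j (X i ω) - ∑ i, l' (X i ω)))) := by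
        rw [hlamdef]; field_simp
      rw [this]
      exact mul_le_mul_of_nonneg_left h3 (by positivity)
    simp only [hG, Finset.sum_sub_distrib, mul_sub, ← div_eq_inv_mul]
    have : 64 * K / n * U ω = 4 * (16 * K / n * U ω) := by ring
    rw [this]
    linarith
  have hcomp : ∀ {f : Y → ℝ}, Measurable f → (∀ y, f y ∈ Icc 0 K) → ∀ i,
      Integrable (fun ω => f (X i ω)) μ ∧ ∫ ω, f (X i ω) ∂μ = ∫ y, f y ∂P := by
    intro f hf hfb i
    refine ⟨integrable_of_abs_le (hf.comp (hX i)) (M := K) fun ω => ?_, ?_⟩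
    · rw [abs_of_nonneg (hfb _).1]; exact (hfb _).2
    · rw [← hlaw i, integral_map (hX i).aemeasurable hf.aestronglyMeasurable]
  have hdi : ∀ i, Integrable (fun ω => l₀ (X i ω) - l' (X i ω)) μ := fun i =>
    (hcomp hl₀ hlb₀ i).1.sub (hcomp hl' hlb' i).1
  have hs1 : Integrable (fun ω => 4 * ((n : ℝ)⁻¹ * ∑ i, (l₀ (X i ω) - l' (X i ω)))) μ :=
    ((integrable_finsetSum _ fun i _ => hdi i).const_mul _).const_mul _
  have hs2 : Integrable (fun ω => 6 * r' + 4 * δ' + δ + 64 * K / n * U ω) μ :=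
    (integrable_const _).add (hUi.const_mul _)
  have hGi : Integrable G μ := hs1.add hs2
  calc ∫⁻ ω, ENNReal.ofReal (T ω) ∂μ ≤ ∫⁻ ω, ENNReal.ofReal (G ω) ∂μ :=
        lintegral_mono_ae (hle.mono fun ω h => ENNReal.ofReal_le_ofReal h)
    _ = ENNReal.ofReal (∫ ω, G ω ∂μ) :=
        (ofReal_integral_eq_lintegral_ofReal hGi (hle.mono fun ω h => (hT ω).trans h)).symm
    _ ≤ _ := by
      refine ENNReal.ofReal_le_ofReal ?_
      rw [hG, integral_add hs1 hs2, integral_const_mul, integral_const_mul,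
        integral_finsetSum _ fun i _ => hdi i, integral_add (integrable_const _)
        (hUi.const_mul _), integral_const_mul]
      have : ∀ i, ∫ ω, (l₀ (X i ω) - l' (X i ω)) ∂μ = r₀ - r' := fun i => by
        rw [integral_sub (hcomp hl₀ hlb₀ i).1 (hcomp hl' hlb' i).1, (hcomp hl₀ hlb₀ i).2,
          (hcomp hl' hlb' i).2, hm₀, hm']
        ring
      simp only [this, Finset.sum_const, Finset.card_univ, Fintype.card_fin, nsmul_eq_mul,
        integral_const, probReal_univ, one_smul]
      rw [inv_mul_cancel_left₀ hn'.ne']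
      have h5 : 64 * K / n * ∫ ω, U ω ∂μ ≤ 64 * K / n * Real.log (Fintype.card ι) :=
        mul_le_mul_of_nonneg_left hUle (by positivity)
      have h6 : 64 * K * Real.log (Fintype.card ι) / n
        = 64 * K / n * Real.log (Fintype.card ι) := by ring
      linarith

end Concentration

/-! ### Moments, tails and scores of Gaussian kernels and their mixtures. -/

section Gaussian

variable {D : ℕ}

local notation "𝔼" => EuclideanSpace ℝ (Fin D)

/-- Density at `x` of `N(m y, σ² I_D)`. -/
def gaussDensity (m σ : ℝ) (y x : EuclideanSpace ℝ (Fin D)) : ℝ :=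
  (2 * Real.pi * σ ^ 2) ^ (-(D : ℝ) / 2) * Real.exp (-‖x - m • y‖ ^ 2 / (2 * σ ^ 2))

/-- Score at `x` of `N(m y, σ² I_D)`. -/
def gaussScore (m σ : ℝ) (y x : EuclideanSpace ℝ (Fin D)) : EuclideanSpace ℝ (Fin D) :=
  -((σ ^ 2)⁻¹ • (x - m • y))

/-- `‖x - m y‖² / (4 σ²)`. -/
def quarterSq (m σ : ℝ) (y x : EuclideanSpace ℝ (Fin D)) : ℝ := ‖x - m • y‖ ^ 2 / (4 * σ ^ 2)

lemma quarterSq_nonneg (m σ : ℝ) (y x : 𝔼) : 0 ≤ quarterSq m σ y x := by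
  unfold quarterSq; positivity

lemma norm_gaussScore_sq {σ : ℝ} (hσ : 0 < σ) (m : ℝ) (y x : 𝔼) :
    ‖gaussScore m σ y x‖ ^ 2 = 4 / σ ^ 2 * quarterSq m σ y x := by
  rw [gaussScore, norm_neg, norm_smul, norm_inv, Real.norm_of_nonneg (by positivity), quarterSq]
  field_simp

lemma gaussDensity_pos {σ : ℝ} (hσ : 0 < σ) (m : ℝ) (y x : 𝔼) : 0 < gaussDensity m σ y x := by
  unfold gaussDensity; positivity

lemma gaussDensity_eq {σ : ℝ} (hσ : 0 < σ) (m : ℝ) (y x : 𝔼) :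
    gaussDensity m σ y x
      = (2 * Real.pi * σ ^ 2) ^ (-(D : ℝ) / 2) * Real.exp (-(2 * quarterSq m σ y x)) := by
  rw [gaussDensity, quarterSq]; congr 2; field_simp; norm_num

lemma gaussDensity_le {σ : ℝ} (hσ : 0 < σ) (m : ℝ) (y x : 𝔼) :
    gaussDensity m σ y x ≤ (2 * Real.pi * σ ^ 2) ^ (-(D : ℝ) / 2) := by
  rw [gaussDensity_eq hσ]
  refine mul_le_of_le_one_right (by positivity) (Real.exp_le_one_iff.2 ?_)
  linarith [quarterSq_nonneg m σ y x]

lemma norm_gaussScore_sq_mul_gaussDensity_le {σ : ℝ} (hσ : 0 < σ) (m : ℝ) (y x : 𝔼) :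
    ‖gaussScore m σ y x‖ ^ 2 * gaussDensity m σ y x
      ≤ 4 / σ ^ 2 * (2 * Real.pi * σ ^ 2) ^ (-(D : ℝ) / 2) := by
  rw [gaussDensity_eq hσ, norm_gaussScore_sq hσ]
  have h0 := quarterSq_nonneg m σ y x
  have h1 : quarterSq m σ y x * Real.exp (-(2 * quarterSq m σ y x)) ≤ 1 := by
    rw [Real.exp_neg, ← div_eq_mul_inv, div_le_one (Real.exp_pos _)]
    linarith [Real.add_one_le_exp (2 * quarterSq m σ y x)]
  calc _ = 4 / σ ^ 2 * (2 * Real.pi * σ ^ 2) ^ (-(D : ℝ) / 2)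
        * (quarterSq m σ y x * Real.exp (-(2 * quarterSq m σ y x))) := by ring
    _ ≤ _ := mul_le_of_le_one_right (by positivity) h1

lemma lintegral_exp_neg_mul_sq_norm {b : ℝ} (hb : 0 < b) (w : 𝔼) :
    ∫⁻ x : 𝔼, ENNReal.ofReal (Real.exp (-b * ‖x - w‖ ^ 2))
      = ENNReal.ofReal ((Real.pi / b) ^ ((D : ℝ) / 2)) := by
  have h := GaussianFourier.integral_rexp_neg_mul_sq_norm (V := 𝔼) hb
  rw [finrank_euclideanSpace_fin] at h
  -- Were the function not integrable, its Bochner integral would be 0, against the positive closed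
  -- form in `h`.
  have hi : Integrable (fun x : 𝔼 => Real.exp (-b * ‖x‖ ^ 2)) := by
    by_contra hcon
    rw [integral_undef hcon] at h
    exact absurd h (by positivity)
  have hi' := hi.comp_sub_right w
  rw [← ofReal_integral_eq_lintegral_ofReal hi'
    (Filter.Eventually.of_forall fun _ => (Real.exp_pos _).le),
    integral_sub_right_eq_self (fun x : 𝔼 => Real.exp (-b * ‖x‖ ^ 2)), h]

/-- The exponential tilt turns the kernel into one of variance `σ²/(1 - lam)`, and the result is the
ratio of normalizing constants. The value `lam = 0` gives total mass, `lam = 1/2` the exponential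
moment behind all later bounds. -/
lemma lintegral_exp_mul_gaussDensity {σ : ℝ} (hσ : 0 < σ) (m : ℝ) (y : 𝔼) {lam : ℝ}
    (hlam : lam < 1) :
    ∫⁻ x, ENNReal.ofReal (Real.exp (lam * (2 * quarterSq m σ y x)) * gaussDensity m σ y x)
      = ENNReal.ofReal ((1 - lam)⁻¹ ^ ((D : ℝ) / 2)) := by
  have hb : 0 < (1 - lam) / (2 * σ ^ 2) := div_pos (by linarith) (by positivity)
  have e : ∀ x, ENNReal.ofReal (Real.exp (lam * (2 * quarterSq m σ y x)) * gaussDensity m σ y x)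
      = ENNReal.ofReal ((2 * Real.pi * σ ^ 2) ^ (-(D : ℝ) / 2))
        * ENNReal.ofReal (Real.exp (-((1 - lam) / (2 * σ ^ 2)) * ‖x - m • y‖ ^ 2)) := fun x => by
    rw [← ENNReal.ofReal_mul (by positivity), gaussDensity, mul_left_comm, ← Real.exp_add,
      quarterSq]
    congr 3
    field_simp
    ring
  simp_rw [e]
  rw [lintegral_const_mul' _ _ ENNReal.ofReal_ne_top, lintegral_exp_neg_mul_sq_norm hb,
    ← ENNReal.ofReal_mul (by positivity)]
  congr 1
  have h1 : Real.pi / ((1 - lam) / (2 * σ ^ 2)) = (2 * Real.pi * σ ^ 2) * (1 - lam)⁻¹ := by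
    have : 1 - lam ≠ 0 := by linarith
    field_simp
  have h2 : (0 : ℝ) ≤ (1 - lam)⁻¹ := inv_nonneg.2 (by linarith)
  rw [h1, Real.mul_rpow (by positivity) h2, ← mul_assoc, ← Real.rpow_add (by positivity),
    neg_div, neg_add_cancel, Real.rpow_zero, one_mul]

lemma lintegral_gaussDensity {σ : ℝ} (hσ : 0 < σ) (m : ℝ) (y : 𝔼) :
    ∫⁻ x, ENNReal.ofReal (gaussDensity m σ y x) = 1 := by
  simpa using lintegral_exp_mul_gaussDensity hσ m y (lam := 0) (by norm_num)

lemma lintegral_exp_quarterSq {σ : ℝ} (hσ : 0 < σ) (m : ℝ) (y : 𝔼) :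
    ∫⁻ x, ENNReal.ofReal (Real.exp (quarterSq m σ y x)) * ENNReal.ofReal (gaussDensity m σ y x)
      = ENNReal.ofReal (2 ^ ((D : ℝ) / 2)) := by
  have h := lintegral_exp_mul_gaussDensity hσ m y (lam := 1 / 2) (by norm_num)
  norm_num at h
  rw [← h]
  refine lintegral_congr fun x => ?_
  rw [← ENNReal.ofReal_mul (Real.exp_pos _).le]
  congr 3
  ring

lemma enorm_sq_eq_ofReal {E : Type*} [NormedAddCommGroup E] (v : E) :
    ‖v‖ₑ ^ 2 = ENNReal.ofReal (‖v‖ ^ 2) := by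
  rw [ENNReal.ofReal_pow (norm_nonneg _), ofReal_norm]

lemma enorm_sub_sq_le {E : Type*} [NormedAddCommGroup E] (v w : E) :
    ‖v - w‖ₑ ^ 2 ≤ 2 * ‖v‖ₑ ^ 2 + 2 * ‖w‖ₑ ^ 2 := by
  rw [enorm_sq_eq_ofReal, enorm_sq_eq_ofReal, enorm_sq_eq_ofReal, ← ENNReal.ofReal_ofNat 2,
    ← ENNReal.ofReal_mul (by norm_num), ← ENNReal.ofReal_mul (by norm_num),
    ← ENNReal.ofReal_add (by positivity) (by positivity)]
  refine ENNReal.ofReal_le_ofReal ?_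
  have h : ‖v - w‖ ^ 2 ≤ (‖v‖ + ‖w‖) ^ 2 := by gcongr; exact norm_sub_le v w
  nlinarith [sq_nonneg (‖v‖ - ‖w‖)]

lemma measurable_gaussDensity {Z : Type*} [MeasurableSpace Z] {m σ : Z → ℝ} {x y : Z → 𝔼}
    (hm : Measurable m) (hσ : Measurable σ) (hx : Measurable x) (hy : Measurable y) :
    Measurable fun z => gaussDensity (m z) (σ z) (y z) (x z) :=
  (((hσ.pow_const 2).const_mul _).pow_const _).mul
    (((hx.sub (hm.smul hy)).norm.pow_const 2).neg.div ((hσ.pow_const 2).const_mul _)).exp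

lemma measurable_gaussScore {Z : Type*} [MeasurableSpace Z] {m σ : Z → ℝ} {x y : Z → 𝔼}
    (hm : Measurable m) (hσ : Measurable σ) (hx : Measurable x) (hy : Measurable y) :
    Measurable fun z => gaussScore (m z) (σ z) (y z) (x z) :=
  ((hσ.pow_const 2).inv.smul (hx.sub (hm.smul hy))).neg

lemma measurable_gaussDensity_right (m σ : ℝ) (y : 𝔼) : Measurable (gaussDensity m σ y) :=
  measurable_gaussDensity measurable_const measurable_const measurable_id measurable_const

lemma measurable_gaussDensity_left (m σ : ℝ) (x : 𝔼) :
    Measurable fun y => gaussDensity m σ y x :=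
  measurable_gaussDensity measurable_const measurable_const measurable_const measurable_id

/-- The exact value is `D/σ²`; a crude constant is enough. With `q` the quarter square, `q ≤ c - 1 +
exp(q - c)`, and `c = (D/2) log 2` makes the last term of mean 1. This bounds the moment by
`(4/σ²)(c + 1)`. -/
lemma lintegral_norm_gaussScore_sq_le (hD : 1 ≤ D) {σ : ℝ} (hσ : 0 < σ) (m : ℝ) (y : 𝔼) :
    ∫⁻ x, ‖gaussScore m σ y x‖ₑ ^ 2 * ENNReal.ofReal (gaussDensity m σ y x)
      ≤ ENNReal.ofReal (6 * D / σ ^ 2) := by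
  have hD' : (1 : ℝ) ≤ D := by exact_mod_cast hD
  obtain ⟨c, hc⟩ : ∃ c : ℝ, c = (D : ℝ) / 2 * Real.log 2 := ⟨_, rfl⟩
  have hc0 : 0 ≤ c := by
    have := Real.log_nonneg (one_le_two (α := ℝ)); rw [hc]; positivity
  have hpt : ∀ x, ‖gaussScore m σ y x‖ₑ ^ 2 * ENNReal.ofReal (gaussDensity m σ y x)
      ≤ ENNReal.ofReal (4 / σ ^ 2 * c) * ENNReal.ofReal (gaussDensity m σ y x)
        + ENNReal.ofReal (4 / σ ^ 2 * Real.exp (-c))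
          * (ENNReal.ofReal (Real.exp (quarterSq m σ y x))
            * ENNReal.ofReal (gaussDensity m σ y x)) := fun x => by
    rw [← mul_assoc, ← add_mul, ← ENNReal.ofReal_mul (by positivity),
      ← ENNReal.ofReal_add (by positivity) (by positivity), enorm_sq_eq_ofReal]
    gcongr
    rw [norm_gaussScore_sq hσ, mul_assoc, ← Real.exp_add, ← mul_add]
    gcongr
    linarith [Real.add_one_le_exp (-c + quarterSq m σ y x)]
  refine (lintegral_mono hpt).trans ?_
  rw [lintegral_add_left ((measurable_gaussDensity_right m σ y).ennreal_ofReal.const_mul _),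
    lintegral_const_mul' _ _ ENNReal.ofReal_ne_top, lintegral_const_mul' _ _ ENNReal.ofReal_ne_top,
    lintegral_gaussDensity hσ, lintegral_exp_quarterSq hσ, mul_one,
    ← ENNReal.ofReal_mul (by positivity), ← ENNReal.ofReal_add (by positivity) (by positivity)]
  refine ENNReal.ofReal_le_ofReal ?_
  have h2 : (2 : ℝ) ^ ((D : ℝ) / 2) = Real.exp c := by
    rw [Real.rpow_def_of_pos (by norm_num), hc, mul_comm]
  rw [h2, mul_assoc, ← Real.exp_add, neg_add_cancel, Real.exp_zero, ← mul_add,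
    div_mul_eq_mul_div]
  refine div_le_div_of_nonneg_right ?_ (by positivity)
  have := Real.log_two_lt_d9
  nlinarith

/-- Where the score exceeds `4√H/σ`, the quarter square `u` is at least `4H`, so `u ≤ 2 exp(u/2) ≤ 2
exp(-2H) exp u`, and `exp u` has mean `2^(D/2)`. -/
lemma lintegral_gaussScore_tail_le {σ : ℝ} (hσ : 0 < σ) (m : ℝ) (y : 𝔼) {H : ℝ} (hH : 0 ≤ H) :
    ∫⁻ x, ‖gaussScore m σ y x - normCut (4 * √H / σ) (gaussScore m σ y x)‖ₑ ^ 2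
        * ENNReal.ofReal (gaussDensity m σ y x)
      ≤ ENNReal.ofReal (8 / σ ^ 2 * Real.exp (-(2 * H)) * 2 ^ ((D : ℝ) / 2)) := by
  have hpt : ∀ x, ‖gaussScore m σ y x - normCut (4 * √H / σ) (gaussScore m σ y x)‖ₑ ^ 2
        * ENNReal.ofReal (gaussDensity m σ y x)
      ≤ ENNReal.ofReal (8 / σ ^ 2 * Real.exp (-(2 * H)))
          * (ENNReal.ofReal (Real.exp (quarterSq m σ y x))
            * ENNReal.ofReal (gaussDensity m σ y x)) := fun x => by
    rw [← mul_assoc, ← ENNReal.ofReal_mul (by positivity), enorm_sq_eq_ofReal]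
    gcongr
    by_cases hR : ‖gaussScore m σ y x‖ ≤ 4 * √H / σ
    · rw [normCut, if_pos hR]; simp; positivity
    · rw [normCut, if_neg hR, sub_zero, norm_gaussScore_sq hσ]
      rw [not_le] at hR
      have h1 : (4 * √H / σ) ^ 2 ≤ 4 / σ ^ 2 * quarterSq m σ y x := by
        rw [← norm_gaussScore_sq hσ]; gcongr
      rw [div_pow, mul_pow, Real.sq_sqrt hH, div_mul_eq_mul_div,
        div_le_div_iff_of_pos_right (by positivity)] at h1
      set u := quarterSq m σ y x
      have h2 := Real.add_one_le_exp (u / 2)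
      have h3 : Real.exp (u / 2) ≤ Real.exp (-(2 * H)) * Real.exp u := by
        rw [← Real.exp_add, Real.exp_le_exp]; linarith
      calc 4 / σ ^ 2 * u ≤ 4 / σ ^ 2 * (2 * (Real.exp (-(2 * H)) * Real.exp u)) := by
            gcongr; linarith
        _ = _ := by ring
  refine (lintegral_mono hpt).trans (le_of_eq ?_)
  rw [lintegral_const_mul' _ _ ENNReal.ofReal_ne_top, lintegral_exp_quarterSq hσ,
    ← ENNReal.ofReal_mul (by positivity)]

/-! ### Scores -/

lemma hasFDerivAt_gaussDensity {σ : ℝ} (hσ : 0 < σ) (m : ℝ) (y x : 𝔼) :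
    HasFDerivAt (gaussDensity m σ y)
      (gaussDensity m σ y x • innerSL ℝ (gaussScore m σ y x)) x := by
  have h1 : HasFDerivAt (fun x' : 𝔼 => x' - m • y) (ContinuousLinearMap.id ℝ 𝔼) x :=
    (hasFDerivAt_id x).sub_const _
  have h2 := ((h1.norm_sq.const_mul (-(2 * σ ^ 2)⁻¹)).exp).const_mul
    ((2 * Real.pi * σ ^ 2) ^ (-(D : ℝ) / 2))
  have e : gaussDensity m σ y = fun x' : 𝔼 => (2 * Real.pi * σ ^ 2) ^ (-(D : ℝ) / 2)
      * Real.exp (-(2 * σ ^ 2)⁻¹ * ‖x' - m • y‖ ^ 2) := by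
    ext x'; rw [gaussDensity]; congr 2; field_simp
  rw [e]
  refine h2.congr_fderiv ?_
  ext v
  simp [gaussScore]
  field_simp

lemma condScore_eq (α : ℝ → ℝ) {t : ℝ} (ht : 0 < noiseStd α t) (y x : 𝔼) :
    condScore α y x t = gaussScore (meanCoef α t) (noiseStd α t) y x := by
  refine HasGradientAt.gradient ?_
  rw [hasGradientAt_iff_hasFDerivAt]
  have hpos := gaussDensity_pos ht (meanCoef α t) y x
  refine ((hasFDerivAt_gaussDensity ht (meanCoef α t) y x).log hpos.ne').congr_fderiv ?_
  ext v
  simp [hpos.ne']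

lemma integrable_gaussDensity (P : Measure 𝔼) [IsFiniteMeasure P] {σ : ℝ} (hσ : 0 < σ) (m : ℝ)
    (x : 𝔼) : Integrable (fun y => gaussDensity m σ y x) P :=
  integrable_of_abs_le (measurable_gaussDensity_left m σ x) fun y => by
    rw [abs_of_pos (gaussDensity_pos hσ m y x)]; exact gaussDensity_le hσ m y x

/-- Being uniform in `x` and `y`, this bound serves as a constant dominating function for
differentiating the mixture under the integral, with no moment of the mixing law. -/
lemma norm_gaussDensity_smul_gaussScore_le {σ : ℝ} (hσ : 0 < σ) (m : ℝ) (y x : 𝔼) :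
    ‖gaussDensity m σ y x • gaussScore m σ y x‖
      ≤ (1 + 4 / σ ^ 2) * (2 * Real.pi * σ ^ 2) ^ (-(D : ℝ) / 2) := by
  rw [norm_smul, Real.norm_of_nonneg (gaussDensity_pos hσ m y x).le]
  have h1 := norm_gaussScore_sq_mul_gaussDensity_le hσ m y x
  have h2 := gaussDensity_le hσ m y x
  have h3 : ‖gaussScore m σ y x‖ ≤ 1 + ‖gaussScore m σ y x‖ ^ 2 := by
    nlinarith [sq_nonneg (‖gaussScore m σ y x‖ - 1), norm_nonneg (gaussScore m σ y x)]
  nlinarith [mul_le_mul_of_nonneg_left h3 (gaussDensity_pos hσ m y x).le]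

lemma integrable_gaussDensity_smul_gaussScore (P : Measure 𝔼) [IsFiniteMeasure P] {σ : ℝ}
    (hσ : 0 < σ) (m : ℝ) (x : 𝔼) :
    Integrable (fun y => gaussDensity m σ y x • gaussScore m σ y x) P :=
  Integrable.of_bound ((measurable_gaussDensity_left m σ x).smul
    (measurable_gaussScore measurable_const measurable_const measurable_const
      measurable_id)).aestronglyMeasurable _
    (Filter.Eventually.of_forall fun y => norm_gaussDensity_smul_gaussScore_le hσ m y x)

lemma hasFDerivAt_integral_gaussDensity (P : Measure 𝔼) [IsFiniteMeasure P] {σ : ℝ} (hσ : 0 < σ)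
    (m : ℝ) (x : 𝔼) :
    HasFDerivAt (fun x' => ∫ y, gaussDensity m σ y x' ∂P)
      (innerSL ℝ (∫ y, gaussDensity m σ y x • gaussScore m σ y x ∂P)) x := by
  have hi := integrable_gaussDensity_smul_gaussScore P hσ m x
  have e : innerSL ℝ (∫ y, gaussDensity m σ y x • gaussScore m σ y x ∂P)
      = ∫ y, innerSL ℝ (gaussDensity m σ y x • gaussScore m σ y x) ∂P :=
    ((innerSL ℝ : 𝔼 →L[ℝ] 𝔼 →L[ℝ] ℝ).integral_comp_comm hi).symm
  rw [e]
  refine hasFDerivAt_integral_of_dominated_of_fderiv_le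
    (F' := fun x' y => innerSL ℝ (gaussDensity m σ y x' • gaussScore m σ y x'))
    (bound := fun _ => (1 + 4 / σ ^ 2) * (2 * Real.pi * σ ^ 2) ^ (-(D : ℝ) / 2))
    Filter.univ_mem
    (Filter.Eventually.of_forall fun x' =>
      (measurable_gaussDensity_left m σ x').aestronglyMeasurable)
    (integrable_gaussDensity P hσ m x) ?_ ?_ (integrable_const _) ?_
  · exact (innerSL ℝ : 𝔼 →L[ℝ] 𝔼 →L[ℝ] ℝ).continuous.comp_aestronglyMeasurable
      hi.aestronglyMeasurable
  · refine Filter.Eventually.of_forall fun y x' _ => ?_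
    rw [innerSL_apply_norm]
    exact norm_gaussDensity_smul_gaussScore_le hσ m y x'
  · refine Filter.Eventually.of_forall fun y x' _ => ?_
    refine (hasFDerivAt_gaussDensity hσ m y x').congr_fderiv ?_
    rw [map_smul]

lemma integral_gaussDensity_pos (P : Measure 𝔼) [IsProbabilityMeasure P] {σ : ℝ} (hσ : 0 < σ)
    (m : ℝ) (x : 𝔼) : 0 < ∫ y, gaussDensity m σ y x ∂P := by
  rw [integral_pos_iff_support_of_nonneg (fun y => (gaussDensity_pos hσ m y x).le)
    (integrable_gaussDensity P hσ m x)]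
  have : (Function.support fun y => gaussDensity m σ y x) = univ := by
    ext y; simpa using (gaussDensity_pos hσ m y x).ne'
  simp [this]

lemma ofReal_integral_gaussDensity (P : Measure 𝔼) [IsFiniteMeasure P] {σ : ℝ} (hσ : 0 < σ)
    (m : ℝ) (x : 𝔼) :
    ENNReal.ofReal (∫ y, gaussDensity m σ y x ∂P) = ∫⁻ y, ENNReal.ofReal (gaussDensity m σ y x) ∂P :=
  ofReal_integral_eq_lintegral_ofReal (integrable_gaussDensity P hσ m x)
    (Filter.Eventually.of_forall fun y => (gaussDensity_pos hσ m y x).le)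

/-- The score of the marginal is the posterior mean of the conditional score. -/
lemma trueScore_eq (P : Measure 𝔼) [IsProbabilityMeasure P] (α : ℝ → ℝ) {t : ℝ}
    (ht : 0 < noiseStd α t) (x : 𝔼) :
    trueScore P α x t = ⨍ y, gaussScore (meanCoef α t) (noiseStd α t) y x
      ∂(P.withDensity fun y =>
        ENNReal.ofReal (gaussDensity (meanCoef α t) (noiseStd α t) y x)) := by
  set m := meanCoef α t
  set σ := noiseStd α t
  have hpos := integral_gaussDensity_pos P ht m x
  have hR : ⨍ y, gaussScore m σ y x ∂(P.withDensity fun y => ENNReal.ofReal (gaussDensity m σ y x))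
      = (∫ y, gaussDensity m σ y x ∂P)⁻¹
        • ∫ y, gaussDensity m σ y x • gaussScore m σ y x ∂P := by
    rw [average_eq, integral_withDensity_eq_integral_toReal_smul
      (measurable_gaussDensity_left m σ x).ennreal_ofReal
      (Filter.Eventually.of_forall fun _ => ENNReal.ofReal_lt_top)]
    congr 1
    · rw [measureReal_def, withDensity_apply _ MeasurableSet.univ, Measure.restrict_univ,
        ← ofReal_integral_gaussDensity P ht, ENNReal.toReal_ofReal hpos.le]
    · simp_rw [ENNReal.toReal_ofReal (gaussDensity_pos ht m _ x).le]
  rw [hR]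
  refine HasGradientAt.gradient ?_
  rw [hasGradientAt_iff_hasFDerivAt]
  refine ((hasFDerivAt_integral_gaussDensity P ht m x).log hpos.ne').congr_fderiv ?_
  ext v
  simp only [map_smul]
  simp

end Gaussian

/-! ### The regression problem on `[a, b] × ℝ^D`. -/

section Slab

variable {D : ℕ}

local notation "𝔼" => EuclideanSpace ℝ (Fin D)

/-- Transition density at `z = (t, x)` for the schedule `(m, σ)`. -/
def slabDensity (m σ : ℝ → ℝ) (z : ℝ × EuclideanSpace ℝ (Fin D)) (y : EuclideanSpace ℝ (Fin D)) :
    ℝ := gaussDensity (m z.1) (σ z.1) y z.2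

/-- Conditional score at `z = (t, x)` for the schedule `(m, σ)`. -/
def slabScore (m σ : ℝ → ℝ) (z : ℝ × EuclideanSpace ℝ (Fin D)) (y : EuclideanSpace ℝ (Fin D)) :
    EuclideanSpace ℝ (Fin D) := gaussScore (m z.1) (σ z.1) y z.2

/-- Lebesgue measure on `[a, b] × ℝ^D`. -/
def slabMeasure (D : ℕ) (a b : ℝ) : Measure (ℝ × EuclideanSpace ℝ (Fin D)) :=
  (volume.restrict (Icc a b)).prod volume

instance (a b : ℝ) : SFinite (slabMeasure D a b) := by unfold slabMeasure; infer_instance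

/-- Denoising loss of `s` at `y`, as an integral over the slab. -/
def slabLoss (m σ : ℝ → ℝ) (a b : ℝ)
    (s : ℝ × EuclideanSpace ℝ (Fin D) → EuclideanSpace ℝ (Fin D))
    (y : EuclideanSpace ℝ (Fin D)) : ℝ≥0∞ :=
  ∫⁻ z, ‖s z - slabScore m σ z y‖ₑ ^ 2 * ENNReal.ofReal (slabDensity m σ z y) ∂(slabMeasure D a b)

/-- `∫ E ‖s(X_t, t) - s'(X_t, t)‖² dt`, as an integral over the slab. -/
def slabDist (P : Measure (EuclideanSpace ℝ (Fin D))) (m σ : ℝ → ℝ) (a b : ℝ)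
    (s s' : ℝ × EuclideanSpace ℝ (Fin D) → EuclideanSpace ℝ (Fin D)) : ℝ≥0∞ :=
  ∫⁻ z, ‖s z - s' z‖ₑ ^ 2 * (∫⁻ y, ENNReal.ofReal (slabDensity m σ z y) ∂P) ∂(slabMeasure D a b)

/-- The marginal score, as the posterior mean of the conditional score. -/
def slabTarget (P : Measure (EuclideanSpace ℝ (Fin D))) (m σ : ℝ → ℝ)
    (z : ℝ × EuclideanSpace ℝ (Fin D)) : EuclideanSpace ℝ (Fin D) :=
  ⨍ y, slabScore m σ z y ∂(posterior P (slabDensity m σ) z)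

/-- Posterior mean of the conditional score cut at norm `4 √H / σ_t`. -/
def slabCutTarget (P : Measure (EuclideanSpace ℝ (Fin D))) (m σ : ℝ → ℝ) (H : ℝ)
    (z : ℝ × EuclideanSpace ℝ (Fin D)) : EuclideanSpace ℝ (Fin D) :=
  ⨍ y, normCut (4 * √H / σ z.1) (slabScore m σ z y) ∂(posterior P (slabDensity m σ) z)

/-- `∫_a^b σ_t⁻² dt`. -/
def invVar (σ : ℝ → ℝ) (a b : ℝ) : ℝ≥0∞ := ∫⁻ t in Icc a b, ENNReal.ofReal ((σ t ^ 2)⁻¹)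

variable {m σ : ℝ → ℝ} {a b : ℝ} {P : Measure (EuclideanSpace ℝ (Fin D))} [IsProbabilityMeasure P]

lemma measurable_slabDensity (hm : Measurable m) (hσ : Measurable σ) :
    Measurable (Function.uncurry (slabDensity (D := D) m σ)) :=
  measurable_gaussDensity (hm.comp (measurable_fst.comp measurable_fst))
    (hσ.comp (measurable_fst.comp measurable_fst)) (measurable_snd.comp measurable_fst)
    measurable_snd

lemma measurable_slabScore (hm : Measurable m) (hσ : Measurable σ) :
    Measurable (Function.uncurry (slabScore (D := D) m σ)) :=
  measurable_gaussScore (hm.comp (measurable_fst.comp measurable_fst))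
    (hσ.comp (measurable_fst.comp measurable_fst)) (measurable_snd.comp measurable_fst)
    measurable_snd

lemma measurable_slabDensity_left (hm : Measurable m) (hσ : Measurable σ) (y : 𝔼) :
    Measurable fun z => slabDensity m σ z y :=
  measurable_gaussDensity (hm.comp measurable_fst) (hσ.comp measurable_fst) measurable_snd
    measurable_const

lemma measurable_slabScore_left (hm : Measurable m) (hσ : Measurable σ) (y : 𝔼) :
    Measurable fun z => slabScore m σ z y :=
  measurable_gaussScore (hm.comp measurable_fst) (hσ.comp measurable_fst) measurable_snd
    measurable_const

lemma lintegral_slab_le {G : ℝ × 𝔼 → ℝ≥0∞} (hG : Measurable G)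
    {k : ℝ} (hk : 0 ≤ k) (h : ∀ t, ∫⁻ x, G (t, x) ≤ ENNReal.ofReal (k / σ t ^ 2)) :
    ∫⁻ z, G z ∂(slabMeasure D a b) ≤ ENNReal.ofReal k * invVar σ a b := by
  rw [slabMeasure, lintegral_prod _ hG.aemeasurable, invVar,
    ← lintegral_const_mul' _ _ ENNReal.ofReal_ne_top]
  refine lintegral_mono fun t => (h t).trans (le_of_eq ?_)
  rw [← ENNReal.ofReal_mul hk, div_eq_mul_inv]

lemma lintegral_slabDensity_ne_top (hpos : ∀ t, 0 < σ t) (z : ℝ × 𝔼) :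
    ∫⁻ y, ENNReal.ofReal (slabDensity m σ z y) ∂P ≠ ∞ := by
  unfold slabDensity
  rw [← ofReal_integral_gaussDensity P (hpos _)]
  exact ENNReal.ofReal_ne_top

lemma lintegral_slabScore_sq_ne_top (hpos : ∀ t, 0 < σ t) (z : ℝ × 𝔼) :
    ∫⁻ y, ‖slabScore m σ z y‖ₑ ^ 2 * ENNReal.ofReal (slabDensity m σ z y) ∂P ≠ ∞ := by
  refine ne_top_of_le_ne_top (b := ∫⁻ _ : 𝔼, ENNReal.ofReal (4 / σ z.1 ^ 2 *
    (2 * Real.pi * σ z.1 ^ 2) ^ (-(D : ℝ) / 2)) ∂P) (by simp) (lintegral_mono fun y => ?_)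
  rw [enorm_sq_eq_ofReal, ← ENNReal.ofReal_mul (by positivity)]
  exact ENNReal.ofReal_le_ofReal (norm_gaussScore_sq_mul_gaussDensity_le (hpos _) _ _ _)

lemma measurable_slabTarget (hm : Measurable m) (hσ : Measurable σ) :
    Measurable (slabTarget P m σ) :=
  measurable_average_posterior (measurable_slabDensity hm hσ) (measurable_slabScore hm hσ)

lemma measurable_normCut_slabScore (hm : Measurable m) (hσ : Measurable σ) (H : ℝ) :
    Measurable (Function.uncurry fun (z : ℝ × 𝔼) y =>
      normCut (4 * √H / σ z.1) (slabScore m σ z y)) :=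
  measurable_normCut (R := fun w : (ℝ × 𝔼) × 𝔼 => 4 * √H / σ w.1.1)
    (measurable_const.div (hσ.comp (measurable_fst.comp measurable_fst)))
    (measurable_slabScore hm hσ)

lemma measurable_slabCutTarget (hm : Measurable m) (hσ : Measurable σ) (H : ℝ) :
    Measurable (slabCutTarget P m σ H) :=
  measurable_average_posterior (measurable_slabDensity hm hσ)
    (measurable_normCut_slabScore hm hσ H)

lemma norm_slabCutTarget_le (hpos : ∀ t, 0 < σ t) (H : ℝ) (z : ℝ × 𝔼) :
    ‖slabCutTarget P m σ H z‖ ≤ 4 * √H / σ z.1 := by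
  have : IsFiniteMeasure (posterior P (slabDensity m σ) z) :=
    ⟨by rw [posterior_univ]; exact (lintegral_slabDensity_ne_top hpos z).lt_top⟩
  have hR : 0 ≤ 4 * √H / σ z.1 := div_nonneg (by positivity) (hpos _).le
  exact norm_average_le hR fun y => norm_normCut_le hR _

lemma measurable_slabLoss (hm : Measurable m) (hσ : Measurable σ) {s : ℝ × 𝔼 → 𝔼}
    (hs : Measurable s) : Measurable (slabLoss m σ a b s) :=
  measurable_loss (measurable_slabDensity hm hσ) (measurable_slabScore hm hσ) hs

/-- The bound is uniform in `y` because the Gaussian score has a second moment bounded independently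
of the initial point. -/
lemma slabLoss_le (hD : 1 ≤ D) (hm : Measurable m) (hσ : Measurable σ) (hpos : ∀ t, 0 < σ t)
    {s : ℝ × 𝔼 → 𝔼} (hs : Measurable s) {k : ℝ} (hk : 0 ≤ k)
    (hsk : ∀ z, ‖s z‖ ^ 2 ≤ k / σ z.1 ^ 2) (y : 𝔼) :
    slabLoss m σ a b s y ≤ ENNReal.ofReal (2 * k + 12 * D) * invVar σ a b := by
  refine lintegral_slab_le ((measurable_enorm_sub_sq_mul (measurable_slabDensity hm hσ)
    (measurable_slabScore hm hσ) hs).comp measurable_prodMk_right) (by positivity) fun t => ?_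
  have hpt : ∀ x, ‖s (t, x) - slabScore m σ (t, x) y‖ₑ ^ 2
        * ENNReal.ofReal (slabDensity m σ (t, x) y)
      ≤ ENNReal.ofReal (2 * k / σ t ^ 2) * ENNReal.ofReal (gaussDensity (m t) (σ t) y x)
        + 2 * (‖gaussScore (m t) (σ t) y x‖ₑ ^ 2
          * ENNReal.ofReal (gaussDensity (m t) (σ t) y x)) := fun x => by
    rw [← mul_assoc, ← add_mul]
    change ‖s (t, x) - gaussScore (m t) (σ t) y x‖ₑ ^ 2 * _ ≤ _
    gcongr
    · refine (enorm_sub_sq_le _ _).trans ?_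
      gcongr
      rw [enorm_sq_eq_ofReal, mul_div_assoc, ENNReal.ofReal_mul (by norm_num),
        ENNReal.ofReal_ofNat]
      gcongr
      exact hsk (t, x)
    · exact le_rfl
  refine (lintegral_mono hpt).trans ?_
  rw [lintegral_add_left ((measurable_gaussDensity_right _ _ y).ennreal_ofReal.const_mul _),
    lintegral_const_mul' _ _ ENNReal.ofReal_ne_top, lintegral_const_mul' _ _ (by norm_num),
    lintegral_gaussDensity (hpos t), mul_one]
  refine (add_le_add_right (mul_le_mul_right
    (lintegral_norm_gaussScore_sq_le hD (hpos t) (m t) y) 2) _).trans ?_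
  rw [← ENNReal.ofReal_ofNat 2, ← ENNReal.ofReal_mul (by norm_num),
    ← ENNReal.ofReal_add (by positivity) (by positivity)]
  refine ENNReal.ofReal_le_ofReal (le_of_eq ?_)
  ring

/-- The conditional version of `slabDist`, given the initial point. -/
lemma lintegral_slabDist (hm : Measurable m) (hσ : Measurable σ) {s s' : ℝ × 𝔼 → 𝔼}
    (hs : Measurable s) (hs' : Measurable s') :
    ∫⁻ y, ∫⁻ z, ‖s z - s' z‖ₑ ^ 2 * ENNReal.ofReal (slabDensity m σ z y)
      ∂(slabMeasure D a b) ∂P = slabDist P m σ a b s s' := by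
  have hmeas : Measurable fun w : (ℝ × 𝔼) × 𝔼 =>
      ‖s w.1 - s' w.1‖ₑ ^ 2 * ENNReal.ofReal (slabDensity m σ w.1 w.2) :=
    (((hs.sub hs').comp measurable_fst).enorm.pow_const 2).mul
      (measurable_slabDensity hm hσ).ennreal_ofReal
  have hswap := lintegral_lintegral_swap (μ := slabMeasure D a b) (ν := P)
    (f := fun z y => ‖s z - s' z‖ₑ ^ 2 * ENNReal.ofReal (slabDensity m σ z y)) hmeas.aemeasurable
  rw [← hswap, slabDist]
  refine lintegral_congr fun z => ?_
  exact lintegral_const_mul _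
    ((measurable_slabDensity hm hσ).comp measurable_prodMk_left).ennreal_ofReal

/-- `∫ E ‖s*(X_t, t) - ∇ log p_t(X_t | X₀)‖² dt`. -/
def slabNoise (P : Measure (EuclideanSpace ℝ (Fin D))) (m σ : ℝ → ℝ) (a b : ℝ) : ℝ≥0∞ :=
  ∫⁻ z, ∫⁻ y, ‖slabTarget P m σ z - slabScore m σ z y‖ₑ ^ 2
    ∂(posterior P (slabDensity m σ) z) ∂(slabMeasure D a b)

/-- The noise term is the same for every `s`; it plays the role of the constant `v` in
`lintegral_risk_le`. -/
lemma lintegral_slabLoss (hm : Measurable m) (hσ : Measurable σ) (hpos : ∀ t, 0 < σ t)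
    {s : ℝ × 𝔼 → 𝔼} (hs : Measurable s) :
    ∫⁻ y, slabLoss m σ a b s y ∂P
      = slabDist P m σ a b s (slabTarget P m σ) + slabNoise P m σ a b :=
  lintegral_loss_eq (measurable_slabDensity hm hσ) (measurable_slabScore hm hσ)
    (lintegral_slabDensity_ne_top hpos) (lintegral_slabScore_sq_ne_top hpos) hs

/-- Jensen's inequality under the posterior reduces the distance to the second moment of what is cut
off. After Tonelli the initial point is fixed and the Gaussian tail bound applies. -/
lemma slabDist_slabCutTarget_le (hm : Measurable m) (hσ : Measurable σ) (hpos : ∀ t, 0 < σ t)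
    {H : ℝ} (hH : 0 ≤ H) :
    slabDist P m σ a b (slabCutTarget P m σ H) (slabTarget P m σ)
      ≤ ENNReal.ofReal (8 * Real.exp (-(2 * H)) * 2 ^ ((D : ℝ) / 2)) * invVar σ a b := by
  have hmeas : Measurable fun w : (ℝ × 𝔼) × 𝔼 =>
      ‖slabScore m σ w.1 w.2 - normCut (4 * √H / σ w.1.1) (slabScore m σ w.1 w.2)‖ₑ ^ 2
        * ENNReal.ofReal (slabDensity m σ w.1 w.2) :=
    (((measurable_slabScore hm hσ).sub (measurable_normCut_slabScore hm hσ H)).enorm.pow_const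
      2).mul (measurable_slabDensity hm hσ).ennreal_ofReal
  have hswap := lintegral_lintegral_swap (μ := slabMeasure D a b) (ν := P)
    (f := fun z y => ‖slabScore m σ z y - normCut (4 * √H / σ z.1) (slabScore m σ z y)‖ₑ ^ 2
        * ENNReal.ofReal (slabDensity m σ z y)) hmeas.aemeasurable
  calc _ ≤ ∫⁻ z, ∫⁻ y, ‖slabScore m σ z y - normCut (4 * √H / σ z.1) (slabScore m σ z y)‖ₑ ^ 2
        * ENNReal.ofReal (slabDensity m σ z y) ∂P ∂(slabMeasure D a b) :=
      lintegral_mono fun z => enorm_average_normCut_sub_sq_le (measurable_slabDensity hm hσ)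
        (measurable_slabScore hm hσ) _ z (lintegral_slabDensity_ne_top hpos z)
        (lintegral_slabScore_sq_ne_top hpos z)
    _ ≤ ∫⁻ _ : 𝔼, ENNReal.ofReal (8 * Real.exp (-(2 * H)) * 2 ^ ((D : ℝ) / 2))
        * invVar σ a b ∂P := by
      rw [hswap]
      refine lintegral_mono fun y => ?_
      refine lintegral_slab_le (hmeas.comp measurable_prodMk_right) (by positivity) fun t => ?_
      refine (lintegral_gaussScore_tail_le (hpos t) (m t) y hH).trans (le_of_eq ?_)
      congr 1; ring
    _ = _ := by simp

lemma slabDist_le_add {s s' u : ℝ × 𝔼 → 𝔼} (hm : Measurable m) (hσ : Measurable σ)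
    (hs : Measurable s) (hu : Measurable u) :
    slabDist P m σ a b s s' ≤ 2 * slabDist P m σ a b s u + 2 * slabDist P m σ a b s' u := by
  have hp' : Measurable fun z : ℝ × 𝔼 => ∫⁻ y, ENNReal.ofReal (slabDensity m σ z y) ∂P :=
    (measurable_slabDensity hm hσ).ennreal_ofReal.lintegral_prod_right'
  have h1 : Measurable fun z => ‖s z - u z‖ₑ ^ 2
      * (∫⁻ y, ENNReal.ofReal (slabDensity m σ z y) ∂P) := ((hs.sub hu).enorm.pow_const 2).mul hp'
  unfold slabDist
  rw [← lintegral_const_mul' _ _ (by norm_num), ← lintegral_const_mul' _ _ (by norm_num),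
    ← lintegral_add_left (h1.const_mul _)]
  refine lintegral_mono fun z => ?_
  simp only
  rw [← mul_assoc, ← mul_assoc, ← add_mul]
  gcongr
  simpa using enorm_sub_sq_le (s z - u z) (s' z - u z)

lemma slabDist_comm (s s' : ℝ × 𝔼 → 𝔼) : slabDist P m σ a b s s' = slabDist P m σ a b s' s := by
  unfold slabDist
  refine lintegral_congr fun z => ?_
  rw [← enorm_neg, neg_sub]

/-- Uniformly close functions have close conditional distance. -/
lemma lintegral_enorm_sub_sq_mul_slabDensity_le (hm : Measurable m) (hσ : Measurable σ)
    (hpos : ∀ t, 0 < σ t) (hσ1 : ∀ t, σ t ≤ 1) {s s' : ℝ × 𝔼 → 𝔼} (hs : Measurable s)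
    (hs' : Measurable s') {e : ℝ} (he : 0 ≤ e)
    (h : ∀ t ∈ Icc a b, ∀ x, ‖s (t, x) - s' (t, x)‖ ^ 2 ≤ e) (y : 𝔼) :
    ∫⁻ z, ‖s z - s' z‖ₑ ^ 2 * ENNReal.ofReal (slabDensity m σ z y) ∂(slabMeasure D a b)
      ≤ ENNReal.ofReal e * invVar σ a b := by
  have hmeas : Measurable fun z : ℝ × 𝔼 =>
      ‖s z - s' z‖ₑ ^ 2 * ENNReal.ofReal (slabDensity m σ z y) :=
    ((hs.sub hs').enorm.pow_const 2).mul
      (measurable_slabDensity_left hm hσ y).ennreal_ofReal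
  rw [slabMeasure, lintegral_prod _ hmeas.aemeasurable, invVar,
    ← lintegral_const_mul' _ _ ENNReal.ofReal_ne_top]
  refine setLIntegral_mono' measurableSet_Icc fun t ht => ?_
  calc _ ≤ ∫⁻ x, ENNReal.ofReal e * ENNReal.ofReal (gaussDensity (m t) (σ t) y x) := by
        refine lintegral_mono fun x => ?_
        rw [enorm_sq_eq_ofReal]
        exact mul_le_mul_left (ENNReal.ofReal_le_ofReal (h t ht x)) _
    _ = ENNReal.ofReal e := by
        rw [lintegral_const_mul' _ _ ENNReal.ofReal_ne_top, lintegral_gaussDensity (hpos t),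
          mul_one]
    -- As `σ_t ≤ 1`, a factor `σ_t⁻²` may be inserted, so that the length of the time interval is
    -- absorbed into `invVar`.
    _ ≤ _ := by
        rw [← ENNReal.ofReal_mul he]
        refine ENNReal.ofReal_le_ofReal (le_mul_of_one_le_right he ?_)
        exact (one_le_inv₀ (pow_pos (hpos t) 2)).2 (pow_le_one₀ (hpos t).le (hσ1 t))

end Slab

/-! ### The oracle inequality on the slab. -/

section SlabOracle

variable {D : ℕ}

local notation "𝔼" => EuclideanSpace ℝ (Fin D)

variable {m σ : ℝ → ℝ} {a b : ℝ} {P : Measure (EuclideanSpace ℝ (Fin D))} [IsProbabilityMeasure P]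

/-- For fixed `y` both losses are squared `L²` norms under the slab measure weighted by the
transition density, and the conditional score cancels in the difference of the two functions. This
is the pointwise form of the Bernstein condition. -/
lemma sq_slabLoss_sub_le (hm : Measurable m) (hσ : Measurable σ) {s s' : ℝ × 𝔼 → 𝔼}
    (hs : Measurable s) (hs' : Measurable s') {K : ℝ} (hK : 0 ≤ K) {y : 𝔼}
    (hsK : slabLoss m σ a b s y ≤ ENNReal.ofReal K)
    (hsK' : slabLoss m σ a b s' y ≤ ENNReal.ofReal K) :
    ((slabLoss m σ a b s y).toReal - (slabLoss m σ a b s' y).toReal) ^ 2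
      ≤ 4 * K * (∫⁻ z, ‖s z - s' z‖ₑ ^ 2 * ENNReal.ofReal (slabDensity m σ z y)
          ∂(slabMeasure D a b)).toReal := by
  have hQ : Measurable fun z : ℝ × 𝔼 => ENNReal.ofReal (slabDensity m σ z y) :=
    (measurable_slabDensity_left hm hσ y).ennreal_ofReal
  have hC : Measurable fun z : ℝ × 𝔼 => slabScore m σ z y :=
    measurable_slabScore_left hm hσ y
  have hf : Measurable fun z : ℝ × 𝔼 => s z - slabScore m σ z y := hs.sub hC
  have hf' : Measurable fun z : ℝ × 𝔼 => s' z - slabScore m σ z y := hs'.sub hC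
  set ρ := (slabMeasure D a b).withDensity fun z => ENNReal.ofReal (slabDensity m σ z y) with hρ
  have key : ∀ f : ℝ × 𝔼 → ℝ≥0∞,
      ∫⁻ z, f z * ENNReal.ofReal (slabDensity m σ z y) ∂(slabMeasure D a b) = ∫⁻ z, f z ∂ρ := by
    intro f
    rw [hρ, lintegral_withDensity_eq_lintegral_mul_non_measurable _ hQ
      (Filter.Eventually.of_forall fun _ => ENNReal.ofReal_lt_top)]
    simp only [Pi.mul_apply, mul_comm]
  have e : ∀ u : ℝ × 𝔼 → 𝔼,
      slabLoss m σ a b u y = ∫⁻ z, ‖u z - slabScore m σ z y‖ₑ ^ 2 ∂ρ := fun u => key _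
  rw [e] at hsK hsK'
  rw [e, e, key]
  have h := sq_lintegral_enorm_sq_sub_le hf hf' hK hsK hsK'
  simp only [sub_sub_sub_cancel_right] at h
  exact h

/-- Oracle inequality over a class of bounded functions on the slab that has a finite `1/n` net. -/
theorem lintegral_slabDist_le (hD : 1 ≤ D) (hm : Measurable m) (hσ : Measurable σ)
    (hpos : ∀ t, 0 < σ t) (hσ1 : ∀ t, σ t ≤ 1) {W : ℝ} (hW : 0 < W)
    (hinv : invVar σ a b = ENNReal.ofReal W) {n : ℕ} (hn : 2 ≤ n) {H : ℝ} (hDH : (D : ℝ) ≤ H)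
    (hnH : Real.log n ≤ H) {C K : ℝ} (hK : K = (2 * C ^ 2 + 44) * (D * H * W))
    {F : Set (ℝ × 𝔼 → 𝔼)} (hF : ∀ s ∈ F, Measurable s)
    (hFb : ∀ s ∈ F, ∀ z, ‖s z‖ ^ 2 ≤ C ^ 2 * (D * H) / σ z.1 ^ 2)
    {ι : Type*} [Fintype ι] [Nonempty ι] {g : ι → ℝ × 𝔼 → 𝔼} (hg : ∀ j, g j ∈ F)
    (hcov : ∀ s ∈ F, ∃ j, ∀ t ∈ Icc a b, ∀ x, ‖s (t, x) - g j (t, x)‖ ^ 2 ≤ D / (n : ℝ) ^ 2)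
    {Ω : Type*} [MeasurableSpace Ω] {μ : Measure Ω} [IsProbabilityMeasure μ]
    {X : Fin n → Ω → 𝔼} (hX : ∀ i, Measurable (X i)) (hlaw : ∀ i, μ.map (X i) = P)
    (hind : iIndepFun X μ) {sHat : Ω → ℝ × 𝔼 → 𝔼} {η : ℝ} (hη : 0 ≤ η)
    (hmin : ∀ᵐ ω ∂μ, sHat ω ∈ F ∧ ∀ s ∈ F, (∑ i, slabLoss m σ a b (sHat ω) (X i ω)) / (n : ℝ≥0∞)
      ≤ (∑ i, slabLoss m σ a b s (X i ω)) / (n : ℝ≥0∞) + ENNReal.ofReal η)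
    {s₀ : ℝ × 𝔼 → 𝔼} (hs₀ : s₀ ∈ F) :
    ∫⁻ ω, slabDist P m σ a b (sHat ω) (slabTarget P m σ) ∂μ
      ≤ 4 * slabDist P m σ a b s₀ (slabTarget P m σ)
        + ENNReal.ofReal (4 * η + (12 + 64 * Real.log (Fintype.card ι)) * K / n) := by
  have hn0 : (0 : ℝ) < n := by positivity
  have hn1 : (1 : ℝ) ≤ n := by exact_mod_cast (by lia : 1 ≤ n)
  have hD' : (1 : ℝ) ≤ D := by exact_mod_cast hD
  have hH : 1 ≤ H := hD'.trans hDH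
  have hDHW : W ≤ D * H * W := le_mul_of_one_le_left hW.le (by nlinarith)
  have hDW : D * W ≤ D * H * W := by
    rw [mul_right_comm]; exact le_mul_of_one_le_right (by positivity) hH
  -- The cut target has squared norm at most `16H/σ²`, so `slabLoss_le` gives `32H + 12D ≤ 44DH` for
  -- its loss.
  have hK44 : 44 * (D * H * W) ≤ K := by
    rw [hK]; gcongr; nlinarith [sq_nonneg C]
  have hKpos : 0 < K := lt_of_lt_of_le (by positivity) hK44
  set tgt := slabTarget P m σ
  set cut := slabCutTarget P m σ H
  have htm : Measurable tgt := measurable_slabTarget hm hσ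
  have hcm : Measurable cut := measurable_slabCutTarget hm hσ H
  -- bounds on the losses
  have hlossF : ∀ s ∈ F, ∀ y, slabLoss m σ a b s y ≤ ENNReal.ofReal K := fun s hs y => by
    refine (slabLoss_le hD hm hσ hpos (hF s hs) (by positivity) (hFb s hs) y).trans ?_
    rw [hinv, ← ENNReal.ofReal_mul (by positivity)]
    refine ENNReal.ofReal_le_ofReal ?_
    rw [hK]
    nlinarith
  have hlossC : ∀ y, slabLoss m σ a b cut y ≤ ENNReal.ofReal K := fun y => by
    refine (slabLoss_le (k := 16 * H) hD hm hσ hpos hcm (by positivity) (fun z => ?_) y).trans ?_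
    · calc ‖cut z‖ ^ 2 ≤ (4 * √H / σ z.1) ^ 2 := by
            gcongr; exact norm_slabCutTarget_le hpos H z
        _ = 16 * H / σ z.1 ^ 2 := by
            rw [div_pow, mul_pow, Real.sq_sqrt (by linarith)]; norm_num
    · rw [hinv, ← ENNReal.ofReal_mul (by positivity)]
      refine ENNReal.ofReal_le_ofReal (le_trans ?_ hK44)
      have : H * W ≤ D * H * W := by
        rw [mul_assoc]; exact le_mul_of_one_le_left (by positivity) hD'
      nlinarith
  -- mean losses
  have hmean : ∀ s : ℝ × 𝔼 → 𝔼, Measurable s → (∀ y, slabLoss m σ a b s y ≤ ENNReal.ofReal K) →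
      slabDist P m σ a b s tgt ≤ ENNReal.ofReal K ∧ slabNoise P m σ a b ≤ ENNReal.ofReal K ∧
      ∫ y, (slabLoss m σ a b s y).toReal ∂P
        = (slabDist P m σ a b s tgt).toReal + (slabNoise P m σ a b).toReal := by
    intro s hs hb
    have h1 := lintegral_slabLoss (P := P) (a := a) (b := b) hm hσ hpos hs
    have h2 : ∫⁻ y, slabLoss m σ a b s y ∂P ≤ ENNReal.ofReal K :=
      (lintegral_mono hb).trans (by simp)
    have h3 : slabDist P m σ a b s tgt ≤ ENNReal.ofReal K := (le_self_add.trans h1.ge).trans h2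
    have h4 : slabNoise P m σ a b ≤ ENNReal.ofReal K := (le_add_self.trans h1.ge).trans h2
    refine ⟨h3, h4, ?_⟩
    rw [integral_toReal (measurable_slabLoss hm hσ hs).aemeasurable
      (Filter.Eventually.of_forall fun y => (hb y).trans_lt ENNReal.ofReal_lt_top), h1,
      ENNReal.toReal_add (ne_top_of_le_ne_top ENNReal.ofReal_ne_top h3)
      (ne_top_of_le_ne_top ENNReal.ofReal_ne_top h4)]
  have hIcc : ∀ s : ℝ × 𝔼 → 𝔼, (∀ y, slabLoss m σ a b s y ≤ ENNReal.ofReal K) →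
      ∀ y, (slabLoss m σ a b s y).toReal ∈ Icc 0 K := fun s hb y =>
    ⟨ENNReal.toReal_nonneg, ENNReal.toReal_le_of_le_ofReal hKpos.le (hb y)⟩
  have hdist_fin : ∀ s ∈ F, slabDist P m σ a b s tgt ≠ ∞ := fun s hs =>
    ne_top_of_le_ne_top ENNReal.ofReal_ne_top (hmean s (hF s hs) (hlossF s hs)).1
  have hcut_fin : slabDist P m σ a b cut tgt ≠ ∞ :=
    ne_top_of_le_ne_top ENNReal.ofReal_ne_top (hmean cut hcm hlossC).1
  -- Bernstein condition: integrating the pointwise bound over `y` gives `4K` times the distance of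
  -- `s` to the cut target, which goes through the true target at the price of a factor 2.
  have hvar : ∀ s ∈ F, ∫ y, ((slabLoss m σ a b s y).toReal - (slabLoss m σ a b cut y).toReal) ^ 2 ∂P
      ≤ 8 * K * ((slabDist P m σ a b s tgt).toReal + (slabDist P m σ a b cut tgt).toReal) := by
    intro s hs
    have hle := slabDist_le_add (P := P) (a := a) (b := b) (s' := cut) hm hσ (hF s hs) htm
    have hfin : 2 * slabDist P m σ a b s tgt + 2 * slabDist P m σ a b cut tgt ≠ ∞ :=
      ENNReal.add_ne_top.2 ⟨ENNReal.mul_ne_top (by norm_num) (hdist_fin s hs),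
        ENNReal.mul_ne_top (by norm_num) hcut_fin⟩
    have hcond := lintegral_slabDist (P := P) (a := a) (b := b) hm hσ (hF s hs) hcm
    have hcondm : Measurable fun y => ∫⁻ z, ‖s z - cut z‖ₑ ^ 2
        * ENNReal.ofReal (slabDensity m σ z y) ∂(slabMeasure D a b) :=
      Measurable.lintegral_prod_left' (f := fun w : (ℝ × 𝔼) × 𝔼 =>
        ‖s w.1 - cut w.1‖ₑ ^ 2 * ENNReal.ofReal (slabDensity m σ w.1 w.2))
        (((((hF s hs).sub hcm).comp measurable_fst).enorm.pow_const 2).mul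
          (measurable_slabDensity hm hσ).ennreal_ofReal)
    have hcond_fin : ∫⁻ y, ∫⁻ z, ‖s z - cut z‖ₑ ^ 2 * ENNReal.ofReal (slabDensity m σ z y)
        ∂(slabMeasure D a b) ∂P ≠ ∞ := by
      rw [hcond]; exact ne_top_of_le_ne_top hfin hle
    have hint := integrable_toReal_of_lintegral_ne_top hcondm.aemeasurable hcond_fin
    calc _ ≤ ∫ y, 4 * K * (∫⁻ z, ‖s z - cut z‖ₑ ^ 2 * ENNReal.ofReal (slabDensity m σ z y)
          ∂(slabMeasure D a b)).toReal ∂P :=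
        integral_mono_of_nonneg (Filter.Eventually.of_forall fun _ => sq_nonneg _)
          (hint.const_mul _) (Filter.Eventually.of_forall fun y =>
            sq_slabLoss_sub_le hm hσ (hF s hs) hcm hKpos.le (hlossF s hs y) (hlossC y))
      _ = 4 * K * (slabDist P m σ a b s cut).toReal := by
        rw [integral_const_mul, integral_toReal hcondm.aemeasurable
          (ae_lt_top hcondm hcond_fin), hcond]
      _ ≤ 4 * K * (2 * (slabDist P m σ a b s tgt).toReal
            + 2 * (slabDist P m σ a b cut tgt).toReal) := by
        refine mul_le_mul_of_nonneg_left ?_ (by positivity)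
        refine (ENNReal.toReal_mono hfin hle).trans (le_of_eq ?_)
        rw [ENNReal.toReal_add (ENNReal.mul_ne_top (by norm_num) (hdist_fin s hs))
          (ENNReal.mul_ne_top (by norm_num) hcut_fin)]
        simp
      _ = _ := by ring
  -- the net
  have hclose : ∀ s ∈ F, ∃ j, slabDist P m σ a b s (g j) ≤ ENNReal.ofReal (K / n) ∧
      ∀ y, (slabLoss m σ a b (g j) y).toReal ≤ (slabLoss m σ a b s y).toReal + 2 * K / n := by
    intro s hs
    obtain ⟨j, hj⟩ := hcov s hs
    have hcl := lintegral_enorm_sub_sq_mul_slabDensity_le hm hσ hpos hσ1 (hF s hs)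
      (hF _ (hg j)) (by positivity) hj
    have hDWK : D / (n : ℝ) ^ 2 * W ≤ K / n ^ 2 := by
      rw [div_mul_eq_mul_div]; gcongr; linarith
    simp_rw [hinv, ← ENNReal.ofReal_mul (by positivity : 0 ≤ (D : ℝ) / (n : ℝ) ^ 2)] at hcl
    refine ⟨j, ?_, fun y => ?_⟩
    · rw [← lintegral_slabDist hm hσ (hF s hs) (hF _ (hg j))]
      refine (lintegral_mono hcl).trans ?_
      simp only [lintegral_const, measure_univ, mul_one]
      refine ENNReal.ofReal_le_ofReal (hDWK.trans ?_)
      gcongr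
      nlinarith
    · have h1 := sq_slabLoss_sub_le hm hσ (hF _ (hg j)) (hF s hs) hKpos.le
        (hlossF _ (hg j) y) (hlossF s hs y)
      have h2 : (∫⁻ z, ‖g j z - s z‖ₑ ^ 2 * ENNReal.ofReal (slabDensity m σ z y)
          ∂(slabMeasure D a b)).toReal ≤ K / n ^ 2 := by
        refine ENNReal.toReal_le_of_le_ofReal (by positivity) ?_
        refine le_trans (le_of_eq ?_) ((hcl y).trans (ENNReal.ofReal_le_ofReal hDWK))
        refine lintegral_congr fun z => ?_
        rw [← enorm_neg, neg_sub]
      have h3 : ((slabLoss m σ a b (g j) y).toReal - (slabLoss m σ a b s y).toReal) ^ 2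
          ≤ (2 * K / n) ^ 2 := by
        refine h1.trans ((mul_le_mul_of_nonneg_left h2 (by positivity)).trans (le_of_eq ?_))
        ring
      have := abs_le_of_sq_le_sq h3 (by positivity)
      linarith [(abs_le.1 this).2]
  -- bias of the truncated target
  have hbias : (slabDist P m σ a b cut tgt).toReal ≤ K / n := by
    refine ENNReal.toReal_le_of_le_ofReal (by positivity) ?_
    refine (slabDist_slabCutTarget_le hm hσ hpos (by linarith)).trans ?_
    rw [hinv, ← ENNReal.ofReal_mul (by positivity)]
    refine ENNReal.ofReal_le_ofReal ?_
    -- The dimensional factor consumes one of the two factors `exp(-H)` of the tail bound, by `D ≤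
    -- H`; the other is at most `1/n`, by `log n ≤ H`.
    have h2 : (2 : ℝ) ^ ((D : ℝ) / 2) ≤ Real.exp H := by
      rw [Real.rpow_def_of_pos (by norm_num), Real.exp_le_exp]
      have := Real.log_two_lt_d9
      nlinarith
    have h3 : Real.exp (-H) ≤ 1 / n := by
      rw [Real.exp_neg, ← one_div]
      gcongr
      calc (n : ℝ) = Real.exp (Real.log n) := (Real.exp_log hn0).symm
        _ ≤ _ := Real.exp_le_exp.2 hnH
    calc 8 * Real.exp (-(2 * H)) * 2 ^ ((D : ℝ) / 2) * W
        ≤ 8 * Real.exp (-(2 * H)) * Real.exp H * W := by gcongr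
      _ = 8 * Real.exp (-H) * W := by
        rw [mul_assoc 8, ← Real.exp_add]; ring_nf
      _ ≤ 8 * (1 / n) * W := by gcongr
      _ = (8 * W) / n := by ring
      _ ≤ K / n := by gcongr; linarith
  have hT : ∀ᵐ ω ∂μ, slabDist P m σ a b (sHat ω) tgt
      = ENNReal.ofReal (slabDist P m σ a b (sHat ω) tgt).toReal :=
    hmin.mono fun ω h => (ENNReal.ofReal_toReal (hdist_fin _ h.1)).symm
  rw [lintegral_congr_ae hT]
  -- In units of `K/n` the remainder is `2 + 8 + 2 = 12`: from `2r'` (bias of the cut target), `4δ'`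
  -- (loss at the net point) and `δ` (distance to the net point). The optimization error adds `4η`.
  refine (lintegral_risk_le (l := fun j y => (slabLoss m σ a b (g j) y).toReal)
    (l' := fun y => (slabLoss m σ a b cut y).toReal)
    (l₀ := fun y => (slabLoss m σ a b s₀ y).toReal) (by lia : 0 < n) hX hlaw hind
    (fun j => (measurable_slabLoss hm hσ (hF _ (hg j))).ennreal_toReal)
    (measurable_slabLoss hm hσ hcm).ennreal_toReal
    (measurable_slabLoss hm hσ (hF _ hs₀)).ennreal_toReal hKpos
    (fun j => hIcc _ (hlossF _ (hg j))) (hIcc _ hlossC) (hIcc _ (hlossF _ hs₀))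
    (fun j => (hmean _ (hF _ (hg j)) (hlossF _ (hg j))).2.2) (hmean _ hcm hlossC).2.2
    (hmean _ (hF _ hs₀) (hlossF _ hs₀)).2.2 (fun j => hvar _ (hg j))
    (fun ω => ENNReal.toReal_nonneg) (δ := 2 * (K / n)) (δ' := 2 * K / n + η) ?_).trans ?_
  · filter_upwards [hmin] with ω hω
    obtain ⟨j, hj1, hj2⟩ := hclose _ hω.1
    refine ⟨j, ?_, ?_⟩
    · have h1 := slabDist_le_add (P := P) (a := a) (b := b) (s' := tgt) hm hσ (hF _ hω.1)
        (hF _ (hg j))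
      rw [slabDist_comm tgt] at h1
      have hjf : slabDist P m σ a b (sHat ω) (g j) ≠ ∞ :=
        ne_top_of_le_ne_top ENNReal.ofReal_ne_top hj1
      have h2 := ENNReal.toReal_mono (ENNReal.add_ne_top.2
        ⟨ENNReal.mul_ne_top (by norm_num) hjf,
          ENNReal.mul_ne_top (by norm_num) (hdist_fin _ (hg j))⟩) h1
      rw [ENNReal.toReal_add (ENNReal.mul_ne_top (by norm_num) hjf)
        (ENNReal.mul_ne_top (by norm_num) (hdist_fin _ (hg j)))] at h2
      have h3 := ENNReal.toReal_le_of_le_ofReal (by positivity) hj1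
      simp only [ENNReal.toReal_mul, ENNReal.toReal_ofNat] at h2
      linarith
    · have hlf : ∀ s ∈ F, ∀ i, slabLoss m σ a b s (X i ω) ≠ ∞ := fun s hs i =>
        ne_top_of_le_ne_top ENNReal.ofReal_ne_top (hlossF s hs _)
      have hsum : ∀ s ∈ F, (∑ i, slabLoss m σ a b s (X i ω)) / (n : ℝ≥0∞) ≠ ∞ := fun s hs =>
        ENNReal.div_ne_top (ENNReal.sum_ne_top.2 fun i _ => hlf s hs i)
          (by simp; lia)
      have h1 := ENNReal.toReal_mono (ENNReal.add_ne_top.2 ⟨hsum s₀ hs₀, ENNReal.ofReal_ne_top⟩)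
        (hω.2 s₀ hs₀)
      rw [ENNReal.toReal_add (hsum s₀ hs₀) ENNReal.ofReal_ne_top, ENNReal.toReal_div,
        ENNReal.toReal_div, ENNReal.toReal_sum fun i _ => hlf _ hω.1 i,
        ENNReal.toReal_sum fun i _ => hlf _ hs₀ i, ENNReal.toReal_ofReal hη,
        ENNReal.toReal_natCast] at h1
      have h2 : (∑ i, (slabLoss m σ a b (g j) (X i ω)).toReal) / n
          ≤ (∑ i, (slabLoss m σ a b (sHat ω) (X i ω)).toReal) / n + 2 * K / n := by
        have := Finset.sum_le_sum fun i (_ : i ∈ Finset.univ) => hj2 (X i ω)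
        rw [Finset.sum_add_distrib] at this
        simp only [Finset.sum_const, Finset.card_univ, Fintype.card_fin, nsmul_eq_mul,
          mul_div_cancel₀ _ hn0.ne'] at this
        rw [← add_div, div_le_div_iff_of_pos_right hn0]
        linarith
      linarith
  · have e0 : 4 * slabDist P m σ a b s₀ tgt
        = ENNReal.ofReal (4 * (slabDist P m σ a b s₀ tgt).toReal) := by
      rw [ENNReal.ofReal_mul (by norm_num), ENNReal.ofReal_toReal (hdist_fin s₀ hs₀),
        ENNReal.ofReal_ofNat]
    rw [e0, ← ENNReal.ofReal_add (by positivity) (by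
        have := Real.log_nonneg (by exact_mod_cast Fintype.card_pos (α := ι) :
          (1 : ℝ) ≤ Fintype.card ι)
        positivity)]
    refine ENNReal.ofReal_le_ofReal ?_
    have e : (12 + 64 * Real.log (Fintype.card ι)) * K / n
      = 12 * (K / n) + 64 * K * Real.log (Fintype.card ι) / n := by ring
    have e2 : 2 * K / n = 2 * (K / n) := by ring
    rw [e, e2]
    linarith

end SlabOracle

/-! ### Truncation of real numbers. -/

section Truncation

lemma trunc_mem {l u : ℝ} (h : l ≤ u) (v : ℝ) : trunc l u v ∈ Icc l u :=
  ⟨le_max_left _ _, max_le h (min_le_left _ _)⟩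

lemma trunc_of_mem {l u v : ℝ} (h : v ∈ Icc l u) : trunc l u v = v := by
  rw [trunc, min_eq_right h.2, max_eq_right h.1]

lemma continuous_trunc (l u : ℝ) : Continuous (trunc l u) := by unfold trunc; fun_prop

lemma abs_trunc_le {k : ℝ} (hk : 0 ≤ k) (v : ℝ) : |trunc (-k) k v| ≤ k :=
  abs_le.2 (trunc_mem (by linarith) v)

end Truncation

/-! ### Regularity and monotonicity of the noise schedule. -/

section Schedule

variable {α : ℝ → ℝ} {a b : ℝ}

/-- Freezing time outside `[a, b]` gives coefficients that are measurable on all of `ℝ` and a noise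
level that is positive there. The slab integrals only see `[a, b]`, where nothing changes. -/
lemma continuous_integral_trunc (ha : 0 < a) (hab : a < b)
    (hint : IntervalIntegrable α volume 0 b) :
    Continuous fun t => ∫ u in (0 : ℝ)..trunc a b t, α u := by
  have h := intervalIntegral.continuousOn_primitive_interval' hint left_mem_uIcc
  refine h.comp_continuous (continuous_trunc a b) fun t => ?_
  have := trunc_mem hab.le t
  rw [uIcc_of_le (ha.trans hab).le]
  exact ⟨ha.le.trans this.1, this.2⟩

lemma measurable_meanCoef_trunc (ha : 0 < a) (hab : a < b)
    (hint : IntervalIntegrable α volume 0 b) :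
    Measurable fun t => meanCoef α (trunc a b t) :=
  (Real.continuous_exp.comp (continuous_integral_trunc ha hab hint).neg).measurable

lemma measurable_noiseStd_trunc (ha : 0 < a) (hab : a < b)
    (hint : IntervalIntegrable α volume 0 b) :
    Measurable fun t => noiseStd α (trunc a b t) := by
  have h := continuous_integral_trunc ha hab hint
  have : Continuous fun t => noiseStd α (trunc a b t) := by unfold noiseStd; fun_prop
  exact this.measurable

lemma noiseStd_le_one (t : ℝ) : noiseStd α t ≤ 1 := by
  rw [noiseStd, Real.sqrt_le_one]
  linarith [Real.exp_pos (-2 * ∫ u in (0 : ℝ)..t, α u)]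

lemma noiseStd_le_noiseStd (ha : 0 < a) (hα : ∀ t, 0 ≤ t → 0 ≤ α t)
    (hint : IntervalIntegrable α volume 0 b) {t : ℝ} (ht : t ∈ Icc a b) :
    noiseStd α a ≤ noiseStd α t := by
  have ht0 : 0 ≤ t := ha.le.trans ht.1
  have hsub : IntervalIntegrable α volume 0 t :=
    hint.mono_set (by
      rw [uIcc_of_le ht0, uIcc_of_le (ht0.trans ht.2)]; exact Icc_subset_Icc_right ht.2)
  have h := intervalIntegral.integral_mono_interval (μ := volume) (f := α) le_rfl ha.le ht.1
    ((ae_restrict_iff' measurableSet_Ioc).2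
      (Filter.Eventually.of_forall fun u hu => hα u hu.1.le)) hsub
  refine Real.sqrt_le_sqrt ?_
  have := Real.exp_le_exp.2 (by linarith : -2 * (∫ u in (0 : ℝ)..t, α u)
    ≤ -2 * ∫ u in (0 : ℝ)..a, α u)
  linarith

end Schedule

/-! ### The losses of the statement as slab integrals. -/

section Losses

variable {D : ℕ}

local notation "𝔼" => EuclideanSpace ℝ (Fin D)

variable {α : ℝ → ℝ} {a b : ℝ}

lemma denoisingLoss_eq (ha : 0 < a) (hab : a < b) (hint : IntervalIntegrable α volume 0 b)
    (hpos : ∀ t ∈ Icc a b, 0 < noiseStd α t) {s : 𝔼 → ℝ → 𝔼}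
    (hs : Measurable fun z : ℝ × 𝔼 => s z.2 z.1) (y : 𝔼) :
    denoisingLoss α a b s y = slabLoss (fun t => meanCoef α (trunc a b t))
      (fun t => noiseStd α (trunc a b t)) a b (fun z => s z.2 z.1) y := by
  have hm := measurable_meanCoef_trunc ha hab hint
  have hσ := measurable_noiseStd_trunc ha hab hint
  have hmeas := ((hs.sub (measurable_slabScore_left hm hσ y)).enorm.pow_const 2).mul
    (measurable_slabDensity_left hm hσ y).ennreal_ofReal
  unfold slabLoss slabMeasure denoisingLoss
  refine Eq.trans ?_ (lintegral_prod _ hmeas.aemeasurable).symm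
  refine setLIntegral_congr_fun measurableSet_Icc fun t ht => ?_
  simp only [Pi.mul_apply, Pi.sub_apply, slabScore, slabDensity]
  rw [transLaw, trunc_of_mem ht]
  have hd : Measurable fun x => ENNReal.ofReal (transDensity α t y x) :=
    (measurable_gaussDensity_right _ _ y).ennreal_ofReal
  rw [lintegral_withDensity_eq_lintegral_mul_non_measurable _ hd
    (Filter.Eventually.of_forall fun _ => ENNReal.ofReal_lt_top)]
  refine lintegral_congr fun x => ?_
  rw [Pi.mul_apply, condScore_eq α (hpos t ht), mul_comm]
  rfl

/-- Here `trueScore_eq` turns the gradient of the log density into a posterior mean; from then on no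
derivative appears. -/
lemma scoreRisk_eq (P : Measure 𝔼) [IsProbabilityMeasure P] (ha : 0 < a) (hab : a < b)
    (hint : IntervalIntegrable α volume 0 b) (hpos : ∀ t ∈ Icc a b, 0 < noiseStd α t)
    {s : 𝔼 → ℝ → 𝔼} (hs : Measurable fun z : ℝ × 𝔼 => s z.2 z.1) :
    scoreRisk P α a b s = slabDist P (fun t => meanCoef α (trunc a b t))
      (fun t => noiseStd α (trunc a b t)) a b (fun z => s z.2 z.1)
      (slabTarget P (fun t => meanCoef α (trunc a b t)) fun t => noiseStd α (trunc a b t)) := by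
  have hm := measurable_meanCoef_trunc ha hab hint
  have hσ := measurable_noiseStd_trunc ha hab hint
  have hp : Measurable fun z : ℝ × 𝔼 => ∫⁻ y, ENNReal.ofReal (slabDensity
      (fun t => meanCoef α (trunc a b t)) (fun t => noiseStd α (trunc a b t)) z y) ∂P :=
    (measurable_slabDensity hm hσ).ennreal_ofReal.lintegral_prod_right'
  have hmeas := ((hs.sub (measurable_slabTarget (P := P) hm hσ)).enorm.pow_const 2).mul hp
  unfold slabDist slabMeasure scoreRisk
  refine Eq.trans ?_ (lintegral_prod _ hmeas.aemeasurable).symm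
  refine setLIntegral_congr_fun measurableSet_Icc fun t ht => ?_
  have e : ∀ x, ENNReal.ofReal (margDensity P α t x) = ∫⁻ y, ENNReal.ofReal (slabDensity
      (fun t => meanCoef α (trunc a b t)) (fun t => noiseStd α (trunc a b t)) (t, x) y) ∂P := by
    intro x
    simp only [slabDensity]
    rw [trunc_of_mem ht]
    exact ofReal_integral_gaussDensity P (hpos t ht) _ x
  have hd : Measurable fun x => ENNReal.ofReal (margDensity P α t x) := by
    simp_rw [e]; exact hp.comp measurable_prodMk_left
  simp only [Pi.mul_apply, Pi.sub_apply]
  rw [margLaw, lintegral_withDensity_eq_lintegral_mul_non_measurable _ hd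
    (Filter.Eventually.of_forall fun _ => ENNReal.ofReal_lt_top)]
  refine lintegral_congr fun x => ?_
  rw [Pi.mul_apply, ← e, trueScore_eq P α (hpos t ht), mul_comm]
  simp only [slabTarget, posterior, slabScore, slabDensity, trunc_of_mem ht]

end Losses

/-! ### Measurability, size and sup-norm geometry of the clipped class. -/

section NetworkClass

variable {D : ℕ}

local notation "𝔼" => EuclideanSpace ℝ (Fin D)

lemma continuous_layerValue (L : ℕ) (W : ℕ → ℕ)
    (A : ∀ l : ℕ, Matrix (Fin (W (l + 1))) (Fin (W l)) ℝ)
    (b : ∀ l : ℕ, Fin (W (l + 1)) → ℝ) (l : ℕ) :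
    Continuous fun z => layerValue L W A b z l := by
  induction l with
  | zero => exact continuous_id
  | succ l ih =>
    have h : Continuous fun z => A l *ᵥ layerValue L W A b z l := by fun_prop
    refine continuous_pi fun i => ?_
    have hi : Continuous fun z => (A l *ᵥ layerValue L W A b z l) i + b l i :=
      ((continuous_apply i).comp h).add continuous_const
    by_cases hl : l + 1 < L
    · simpa only [layerValue, if_pos hl] using hi.max continuous_const
    · simpa only [layerValue, if_neg hl] using hi

lemma continuous_of_mem_sparseReLU {L : ℕ} {W : ℕ → ℕ} {S : ℕ} {B : ℝ}
    {f : (Fin (W 0) → ℝ) → (Fin (W L) → ℝ)} (hf : f ∈ sparseReLU L W S B) : Continuous f := by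
  obtain ⟨A, b, -, -, h⟩ := hf
  rw [funext h]
  exact continuous_layerValue L W A b L

lemma continuous_netInput (R a b : ℝ) :
    Continuous fun z : ℝ × 𝔼 => netInput R a b z.2 z.1 := by
  refine continuous_pi fun j => ?_
  unfold netInput
  refine Fin.lastCases ?_ (fun i => ?_) j
  · simp only [Fin.snoc_last]
    exact (((continuous_trunc a b).comp continuous_fst).sub continuous_const).div_const _
  · simp only [Fin.snoc_castSucc]
    refine (Continuous.add ((continuous_trunc (-R) R).comp ?_) continuous_const).div_const _
    fun_prop

variable {α : ℝ → ℝ} {a b : ℝ} {n : ℕ} {Cx Cclip : ℝ} {L : ℕ} {W : ℕ → ℕ} {hW0 : W 0 = D + 1}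
  {hWL : W L = D} {S : ℕ} {B : ℝ} {s : EuclideanSpace ℝ (Fin D) → ℝ → EuclideanSpace ℝ (Fin D)}

lemma measurable_of_mem_clippedClass (ha : 0 < a) (hab : a < b)
    (hint : IntervalIntegrable α volume 0 b)
    (hs : s ∈ clippedClass D n α a b Cx Cclip L W hW0 hWL S B) :
    Measurable fun z : ℝ × 𝔼 => s z.2 z.1 := by
  obtain ⟨f, hf, h⟩ := hs
  have hfc := continuous_of_mem_sparseReLU hf
  have hκ : Measurable fun z : ℝ × 𝔼 =>
      Cclip * (noiseStd α (trunc a b z.1))⁻¹ * logDim D n ^ (1 / 2 : ℝ) :=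
    (((measurable_noiseStd_trunc ha hab hint).comp measurable_fst).inv.const_mul _).mul_const _
  have hin : Continuous fun z : ℝ × 𝔼 => fun j =>
      netInput (logDim D n ^ Cx / noiseStd α a) a b z.2 z.1 (Fin.cast hW0 j) :=
    continuous_pi fun j => (continuous_apply _).comp (continuous_netInput _ a b)
  have hcoord : Measurable fun z : ℝ × 𝔼 => fun i => s z.2 z.1 i := by
    refine measurable_pi_lambda _ fun i => ?_
    simp_rw [h]
    have hfi := (((continuous_apply (Fin.cast hWL.symm i)).comp (hfc.comp hin))).measurable
    exact hκ.neg.max (hκ.min hfi)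
  exact (MeasurableEquiv.toLp 2 (Fin D → ℝ)).measurable.comp hcoord

lemma norm_sq_le_of_mem_clippedClass (hCclip : 0 < Cclip)
    (hs : s ∈ clippedClass D n α a b Cx Cclip L W hW0 hWL S B) (x : 𝔼) (t : ℝ) :
    ‖s x t‖ ^ 2 ≤ Cclip ^ 2 * (D * logDim D n) / noiseStd α (trunc a b t) ^ 2 := by
  obtain ⟨f, -, h⟩ := hs
  have hH : 0 ≤ logDim D n := (Nat.cast_nonneg D).trans (le_max_left _ _)
  have hσ : 0 ≤ noiseStd α (trunc a b t) := Real.sqrt_nonneg _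
  rw [EuclideanSpace.norm_sq_eq]
  calc ∑ i, ‖s x t i‖ ^ 2 ≤ ∑ _i : Fin D,
        (Cclip * (noiseStd α (trunc a b t))⁻¹ * logDim D n ^ (1 / 2 : ℝ)) ^ 2 := by
        refine Finset.sum_le_sum fun i _ => ?_
        rw [h, Real.norm_eq_abs]
        gcongr
        exact abs_trunc_le (by positivity) _
    _ = _ := by
        rw [← Real.sqrt_eq_rpow]
        simp only [mul_pow, Real.sq_sqrt hH, Finset.sum_const, Finset.card_univ,
          Fintype.card_fin, nsmul_eq_mul]
        ring

lemma norm_sub_sq_le_of_edist_le {s s' : 𝔼 → ℝ → 𝔼} {e : ℝ} (he : 0 ≤ e)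
    (h : edist (restrictSlab a b s) (restrictSlab a b s') ≤ ENNReal.ofReal e) {t : ℝ}
    (ht : t ∈ Icc a b) (x : 𝔼) : ‖s x t - s' x t‖ ^ 2 ≤ D * e ^ 2 := by
  have h1 := UniformFun.edist_le.1 h (x, ⟨t, ht⟩)
  rw [EuclideanSpace.norm_sq_eq]
  calc ∑ i, ‖(s x t - s' x t) i‖ ^ 2 ≤ ∑ _i : Fin D, e ^ 2 := by
        refine Finset.sum_le_sum fun i _ => ?_
        have h2 := (edist_le_pi_edist _ _ i).trans h1
        rw [edist_dist] at h2
        have h3 := (ENNReal.ofReal_le_ofReal_iff he).1 h2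
        gcongr
        exact h3
    _ = _ := by simp

end NetworkClass

/-! ### The oracle inequality for the clipped class. -/

section Oracle

variable {D : ℕ}

local notation "𝔼" => EuclideanSpace ℝ (Fin D)

/-- Finiteness comes from `σ ≥ c`, positivity from `σ ≤ 1` and `a < b`. Positivity makes `K > 0`, so
that `1/(16K)` is meaningful. -/
lemma exists_invVar_eq {σ : ℝ → ℝ} {a b c : ℝ} (hab : a < b) (hc : 0 < c)
    (hσ : ∀ t ∈ Icc a b, c ≤ σ t) (hσ1 : ∀ t, σ t ≤ 1) :
    ∃ W : ℝ, 0 < W ∧ invVar σ a b = ENNReal.ofReal W := by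
  have hle : invVar σ a b ≤ ∫⁻ _ in Icc a b, ENNReal.ofReal ((c ^ 2)⁻¹) :=
    setLIntegral_mono' measurableSet_Icc fun t ht => by
      have := hσ t ht
      gcongr
  have hge : ∫⁻ _ in Icc a b, 1 ≤ invVar σ a b :=
    setLIntegral_mono' measurableSet_Icc fun t ht => by
      have h0 := hc.trans_le (hσ t ht)
      rw [ENNReal.one_le_ofReal]
      exact (one_le_inv₀ (pow_pos h0 2)).2 (pow_le_one₀ h0.le (hσ1 t))
  have hfin : invVar σ a b ≠ ∞ := by
    refine ne_top_of_le_ne_top ?_ hle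
    simp [ENNReal.mul_eq_top]
  have hpos : 0 < invVar σ a b := by
    refine lt_of_lt_of_le ?_ hge
    simpa using hab
  exact ⟨(invVar σ a b).toReal, ENNReal.toReal_pos hpos.ne' hfin, (ENNReal.ofReal_toReal hfin).symm⟩

lemma logCovering_eq {a b : ℝ} {n N : ℕ} (hn : 0 < n) {ε : ℝ} {F : Set (𝔼 → ℝ → 𝔼)}
    (hN : Metric.coveringNumber ε.toNNReal (restrictSlab a b '' F) = N) :
    logCovering a b n ε F = ENNReal.ofReal (Real.log (max (N : ℝ) n)) := by
  have e : max ((N : ℕ∞) : ℝ≥0∞) (n : ℝ≥0∞) = ENNReal.ofReal (max (N : ℝ) n) := by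
    rw [ENNReal.ofReal_max]; simp
  rw [logCovering, hN, e, ENNReal.log_ofReal_of_pos (lt_max_of_lt_right (by exact_mod_cast hn)),
    EReal.real_coe_toENNReal]

lemma logCovering_eq_top {a b : ℝ} {n : ℕ} {ε : ℝ} {F : Set (𝔼 → ℝ → 𝔼)}
    (hN : Metric.coveringNumber ε.toNNReal (restrictSlab a b '' F) = ⊤) :
    logCovering a b n ε F = ∞ := by
  simp [logCovering, hN]

/-- The infimum need not be attained, so the inequality for each competitor is solved for `f s` by
truncated subtraction and division before the infimum is taken. -/
lemma le_mul_iInf_add_add {ι : Type*} {F : Set ι} {f : ι → ℝ≥0∞} {x c S e : ℝ≥0∞} (hc0 : c ≠ 0)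
    (hc : c ≠ ∞) (h : ∀ s ∈ F, x ≤ c * (f s + S) + e) : x ≤ c * ((⨅ s ∈ F, f s) + S) + e := by
  rw [← tsub_le_iff_right, mul_comm, ← ENNReal.div_le_iff hc0 hc, ← tsub_le_iff_right]
  refine le_iInf₂ fun s hs => ?_
  rw [tsub_le_iff_right, ENNReal.div_le_iff hc0 hc, mul_comm, tsub_le_iff_right]
  exact h s hs

/-- Oracle inequality for approximate minimizers of the empirical denoising risk over the clipped
class. -/
theorem lintegral_scoreRisk_le {Cx Cclip : ℝ} (hCclip : 0 < Cclip) {n : ℕ} (hn : 2 ≤ n)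
    (hD : 1 ≤ D) {a b : ℝ} (ha : 0 < a) (hab : a < b) {α : ℝ → ℝ} (hα : ∀ t, 0 ≤ t → 0 ≤ α t)
    (hint : IntervalIntegrable α volume 0 b) (hσa : 0 < noiseStd α a)
    {P : Measure (EuclideanSpace ℝ (Fin D))} [IsProbabilityMeasure P]
    {L : ℕ} {W : ℕ → ℕ} {hW0 : W 0 = D + 1} {hWL : W L = D} {S : ℕ} {B : ℝ}
    {Ω : Type*} [MeasurableSpace Ω] {μ : Measure Ω} [IsProbabilityMeasure μ]
    {X : Fin n → Ω → EuclideanSpace ℝ (Fin D)} (hX : ∀ i, Measurable (X i))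
    (hlaw : ∀ i, μ.map (X i) = P) (hind : iIndepFun X μ)
    {sHat : Ω → EuclideanSpace ℝ (Fin D) → ℝ → EuclideanSpace ℝ (Fin D)}
    {F : Set (EuclideanSpace ℝ (Fin D) → ℝ → EuclideanSpace ℝ (Fin D))}
    (hF : F = clippedClass D n α a b Cx Cclip L W hW0 hWL S B) {η : ℝ} (hη : 0 ≤ η)
    (hmin : ∀ᵐ ω ∂μ, IsApproxERM α a b (fun i => X i ω) F (ENNReal.ofReal η) (sHat ω)) :
    ∫⁻ ω, scoreRisk P α a b (sHat ω) ∂μ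
      ≤ ENNReal.ofReal (88 * (2 * Cclip ^ 2 + 44)) * ((⨅ s ∈ F, scoreRisk P α a b s)
          + stochasticTerm α a b n ((n : ℝ) ^ (-1 : ℝ)) F) + ENNReal.ofReal (4 * η) := by
  have hn0 : (0 : ℝ) < n := by positivity
  have hσge : ∀ t ∈ Icc a b, noiseStd α a ≤ noiseStd α t := fun t ht =>
    noiseStd_le_noiseStd ha hα hint ht
  have hposI : ∀ t ∈ Icc a b, 0 < noiseStd α t := fun t ht => hσa.trans_le (hσge t ht)
  set m : ℝ → ℝ := fun t => meanCoef α (trunc a b t)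
  set σ : ℝ → ℝ := fun t => noiseStd α (trunc a b t) with hσdef
  have hm : Measurable m := measurable_meanCoef_trunc ha hab hint
  have hσ : Measurable σ := measurable_noiseStd_trunc ha hab hint
  have hpos : ∀ t, 0 < σ t := fun t => hposI _ (trunc_mem hab.le t)
  have hσ1 : ∀ t, σ t ≤ 1 := fun t => noiseStd_le_one _
  obtain ⟨V, hV, hinv⟩ := exists_invVar_eq (σ := σ) hab hσa
    (fun t _ => hσge _ (trunc_mem hab.le t)) hσ1
  have hinv' : ∫⁻ t in Icc a b, ENNReal.ofReal ((noiseStd α t ^ 2)⁻¹) = ENNReal.ofReal V := by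
    rw [← hinv]
    exact setLIntegral_congr_fun measurableSet_Icc fun t ht => by
      simp only [hσdef, trunc_of_mem ht]
  set H := logDim D n
  have hDH : (D : ℝ) ≤ H := le_max_left _ _
  have hD' : (1 : ℝ) ≤ D := by exact_mod_cast hD
  have hH : 1 ≤ H := hD'.trans hDH
  have hCpos : 0 < 88 * (2 * Cclip ^ 2 + 44) := by positivity
  have hFmeas : ∀ s ∈ F, Measurable fun z : ℝ × 𝔼 => s z.2 z.1 := fun s hs =>
    measurable_of_mem_clippedClass ha hab hint (hF ▸ hs)
  -- If the covering number is infinite, so is the stochastic term, its other factors being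
  -- positive.
  by_cases hN : Metric.coveringNumber ((n : ℝ) ^ (-1 : ℝ)).toNNReal (restrictSlab a b '' F) = ⊤
  · have : stochasticTerm α a b n ((n : ℝ) ^ (-1 : ℝ)) F = ∞ := by
      rw [stochasticTerm, logCovering_eq_top hN, hinv', ENNReal.mul_top, ENNReal.top_div_of_ne_top]
      · exact ENNReal.natCast_ne_top n
      · rw [← ENNReal.ofReal_mul (by positivity)]
        exact (ENNReal.ofReal_pos.2 (by positivity)).ne'
    rw [this, add_top, ENNReal.mul_top (ENNReal.ofReal_pos.2 hCpos).ne', top_add]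
    exact le_top
  obtain ⟨𝒩, h𝒩F, h𝒩fin, h𝒩cov, h𝒩card⟩ := Metric.exists_set_encard_eq_coveringNumber hN
  have hFne : F.Nonempty := by
    obtain ⟨ω, hω⟩ := hmin.exists
    exact ⟨_, hω.1⟩
  have : Fintype 𝒩 := h𝒩fin.fintype
  have : Nonempty 𝒩 := (h𝒩cov.nonempty (hFne.image _)).to_subtype
  have hcard : Metric.coveringNumber ((n : ℝ) ^ (-1 : ℝ)).toNNReal (restrictSlab a b '' F)
      = (Fintype.card 𝒩 : ℕ) := by
    rw [← h𝒩card, Set.encard_eq_coe_toFinset_card, Set.toFinset_card]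
  -- The centres of the cover lie in the covered set, hence are restrictions of members of `F` and
  -- inherit measurability and the clipping bound.
  choose c hcF hc using fun u : 𝒩 => h𝒩F u.2
  set Λ := Real.log (max (Fintype.card 𝒩 : ℝ) n) with hΛ
  have hlogΛ : Real.log (Fintype.card 𝒩) ≤ Λ :=
    Real.log_le_log (by exact_mod_cast Fintype.card_pos) (le_max_left _ _)
  -- This absorbs the additive constant: `12 + 64Λ ≤ 24Λ + 64Λ = 88Λ`, whence the 88.
  have hΛ2 : 1 / 2 ≤ Λ := by
    have h1 : Real.log 2 ≤ Λ := Real.log_le_log (by norm_num)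
      (le_max_of_le_right (by exact_mod_cast hn))
    linarith [Real.log_two_gt_d9]
  have hst : stochasticTerm α a b n ((n : ℝ) ^ (-1 : ℝ)) F
      = ENNReal.ofReal (H ^ 2 * V * Λ / n) := by
    rw [stochasticTerm, logCovering_eq (by lia) hcard, hinv', ← ENNReal.ofReal_mul (by positivity),
      ← ENNReal.ofReal_mul (by positivity), ← ENNReal.ofReal_natCast,
      ← ENNReal.ofReal_div_of_pos hn0]
  have hloss : ∀ s ∈ F, ∀ y, denoisingLoss α a b s y
      = slabLoss m σ a b (fun z => s z.2 z.1) y := fun s hs =>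
    denoisingLoss_eq ha hab hint hposI (hFmeas s hs)
  have hrisk : ∀ s ∈ F, scoreRisk P α a b s
      = slabDist P m σ a b (fun z => s z.2 z.1) (slabTarget P m σ) := fun s hs =>
    scoreRisk_eq P ha hab hint hposI (hFmeas s hs)
  rw [hst]
  refine le_mul_iInf_add_add (ENNReal.ofReal_pos.2 hCpos).ne' ENNReal.ofReal_ne_top fun s₀ hs₀ => ?_
  have key := lintegral_slabDist_le (P := P) (μ := μ) (X := X) (C := Cclip)
    (F := (fun (s : 𝔼 → ℝ → 𝔼) (z : ℝ × 𝔼) => s z.2 z.1) '' F)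
    (g := fun u z => c u z.2 z.1) (sHat := fun ω z => sHat ω z.2 z.1) (s₀ := fun z => s₀ z.2 z.1)
    hD hm hσ hpos hσ1 hV hinv hn hDH (le_max_right _ _ : Real.log n ≤ H) rfl
    (by rintro _ ⟨s, hs, rfl⟩; exact hFmeas s hs)
    (by
      rintro _ ⟨s, hs, rfl⟩ z
      exact norm_sq_le_of_mem_clippedClass hCclip (hF ▸ hs) z.2 z.1)
    (fun u => ⟨_, hcF u, rfl⟩)
    (by
      rintro _ ⟨s, hs, rfl⟩
      obtain ⟨v, hv, hsv⟩ := h𝒩cov (mem_image_of_mem (restrictSlab a b) hs)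
      refine ⟨⟨v, hv⟩, fun t ht x => ?_⟩
      have hsv' : edist (restrictSlab a b s) (restrictSlab a b (c ⟨v, hv⟩))
          ≤ ENNReal.ofReal ((n : ℝ) ^ (-1 : ℝ)) := by rw [hc]; exact hsv
      refine (norm_sub_sq_le_of_edist_le (by positivity) hsv' ht x).trans (le_of_eq ?_)
      rw [Real.rpow_neg_one, inv_pow, div_eq_mul_inv])
    hX hlaw hind hη
    (by
      filter_upwards [hmin] with ω hω
      refine ⟨⟨_, hω.1, rfl⟩, ?_⟩
      rintro _ ⟨s, hs, rfl⟩
      have h := hω.2 s hs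
      simp only [empiricalRisk, hloss _ hω.1, hloss s hs] at h
      exact h)
    ⟨s₀, hs₀, rfl⟩
  have hae : ∀ᵐ ω ∂μ, scoreRisk P α a b (sHat ω)
      = slabDist P m σ a b (fun z => sHat ω z.2 z.1) (slabTarget P m σ) :=
    hmin.mono fun ω hω => hrisk _ hω.1
  rw [lintegral_congr_ae hae, hrisk s₀ hs₀]
  refine key.trans ?_
  have h4 : (4 : ℝ≥0∞) ≤ ENNReal.ofReal (88 * (2 * Cclip ^ 2 + 44)) := by
    rw [← ENNReal.ofReal_ofNat 4]
    exact ENNReal.ofReal_le_ofReal (by nlinarith [sq_nonneg Cclip])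
  have hfinal : 4 * η + (12 + 64 * Real.log (Fintype.card 𝒩))
        * ((2 * Cclip ^ 2 + 44) * (D * H * V)) / n
      ≤ 88 * (2 * Cclip ^ 2 + 44) * (H ^ 2 * V * Λ / n) + 4 * η := by
    have h1 : 12 + 64 * Real.log (Fintype.card 𝒩) ≤ 88 * Λ := by linarith
    have h2 : (D : ℝ) * H * V ≤ H ^ 2 * V := by rw [sq]; gcongr
    have h3 : (12 + 64 * Real.log (Fintype.card 𝒩)) * ((2 * Cclip ^ 2 + 44) * (D * H * V)) / n
        ≤ 88 * Λ * ((2 * Cclip ^ 2 + 44) * (H ^ 2 * V)) / n := by gcongr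
    have h5 : 88 * Λ * ((2 * Cclip ^ 2 + 44) * (H ^ 2 * V)) / n
        = 88 * (2 * Cclip ^ 2 + 44) * (H ^ 2 * V * Λ / n) := by ring
    linarith
  calc _ ≤ ENNReal.ofReal (88 * (2 * Cclip ^ 2 + 44))
          * slabDist P m σ a b (fun z => s₀ z.2 z.1) (slabTarget P m σ)
        + ENNReal.ofReal (88 * (2 * Cclip ^ 2 + 44) * (H ^ 2 * V * Λ / n) + 4 * η) :=
        add_le_add (mul_le_mul_left h4 _) (ENNReal.ofReal_le_ofReal hfinal)
    _ = _ := by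
        rw [ENNReal.ofReal_add (by positivity) (by positivity), ENNReal.ofReal_mul hCpos.le,
          ← add_assoc, ← mul_add]

end Oracle

end ScoreOracle

end

theorem mainTheorem7
    (A a₀ Cx Cclip : ℝ) (hA : 0 < A) (ha₀ : 0 < a₀) (hCx : 0 < Cx) (hCclip : 0 < Cclip) :
    ∃ C A₀ : ℝ, 0 < C ∧ 0 < A₀ ∧
      ∀ (n D : ℕ), 2 ≤ n → 1 ≤ D → (D : ℝ) ≤ (n : ℝ) ^ a₀ →
      ∀ (a b : ℝ), (n : ℝ) ^ (-a₀) ≤ a → a < b → b ≤ (n : ℝ) ^ a₀ →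
      ∀ (α : ℝ → ℝ), (∀ t, 0 ≤ t → 0 ≤ α t) → IntervalIntegrable α volume 0 b →
        0 < ScoreOracle.noiseStd α a →
      ∀ (P₀ : Measure (EuclideanSpace ℝ (Fin D))), IsProbabilityMeasure P₀ →
      ∀ (L : ℕ) (W : ℕ → ℕ) (hW0 : W 0 = D + 1) (hWL : W L = D) (S : ℕ) (B : ℝ), 1 ≤ L →
      ∀ (Ω : Type*) (mΩ : MeasurableSpace Ω) (μ : Measure Ω), IsProbabilityMeasure μ →
      ∀ (X : Fin n → Ω → EuclideanSpace ℝ (Fin D)),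
        (∀ i, Measurable (X i)) → (∀ i, μ.map (X i) = P₀) → iIndepFun X μ →
      ∀ (sHat : Ω → EuclideanSpace ℝ (Fin D) → ℝ → EuclideanSpace ℝ (Fin D)),
        (∀ x t, Measurable fun ω => sHat ω x t) →
      let F := ScoreOracle.clippedClass D n α a b Cx Cclip L W hW0 hWL S B
      ((∀ᵐ ω ∂μ, ScoreOracle.IsApproxERM α a b (fun i => X i ω) F 0 (sHat ω)) →
        ∫⁻ ω, ScoreOracle.scoreRisk P₀ α a b (sHat ω) ∂μ ≤
          ENNReal.ofReal C * ((⨅ s ∈ F, ScoreOracle.scoreRisk P₀ α a b s)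
              + ScoreOracle.stochasticTerm α a b n ((n : ℝ) ^ (-A₀)) F)
            + ENNReal.ofReal ((n : ℝ) ^ (-A))) ∧
      ((∀ᵐ ω ∂μ, ScoreOracle.IsApproxERM α a b (fun i => X i ω) F
            (ENNReal.ofReal ((n : ℝ) ^ (-A))) (sHat ω)) →
        ∫⁻ ω, ScoreOracle.scoreRisk P₀ α a b (sHat ω) ∂μ ≤
          ENNReal.ofReal C * ((⨅ s ∈ F, ScoreOracle.scoreRisk P₀ α a b s)
              + ScoreOracle.stochasticTerm α a b n ((n : ℝ) ^ (-A₀)) F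
              + ENNReal.ofReal ((n : ℝ) ^ (-A)))) := by
  -- An exact minimizer has `η = 0`, so the bound holds even without the term `n^(-A)`; for an
  -- approximate one `4η` is absorbed because the constant exceeds 4.
  refine ⟨88 * (2 * Cclip ^ 2 + 44), 1, by positivity, one_pos, ?_⟩
  intro n D hn hD _ a b hna hab _ α hα hint hσa P₀ hP₀ L W hW0 hWL S B _ Ω mΩ μ hμ X hX hlaw hind
    sHat _ F
  have ha : 0 < a := lt_of_lt_of_le (by positivity) hna
  refine ⟨fun hmin => ?_, fun hmin => ?_⟩
  · refine (ScoreOracle.lintegral_scoreRisk_le hCclip hn hD ha hab hα hint hσa hX hlaw hind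
      (F := F) rfl le_rfl (by simpa using hmin)).trans ?_
    simp
  · refine (ScoreOracle.lintegral_scoreRisk_le hCclip hn hD ha hab hα hint hσa hX hlaw hind
      (F := F) rfl (by positivity) hmin).trans ?_
    rw [mul_add _ (_ + _)]
    gcongr
    rw [← ENNReal.ofReal_mul (by positivity)]
    refine ENNReal.ofReal_le_ofReal ?_
    gcongr
    nlinarith [sq_nonneg Cclip]
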